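/- Let $K$ be an algebraically closed field and let $T$ be a Brauer graph: a finite connected graph with a fixed circular order on the (ends of) edges around each vertex. Assume that $T$ has exactly one cycle, that this cycle is a loop (the edge $1$, attached to the vertex $S$), and that the loop is its own direct successor in the circular order around $S$. Let $1,2,\dots,r$ be the edges attached to $S$, in circular order. Let $Q_T$ be the quiver whose vertices are the edges of $T$, with one arrow $i\to j$ whenever an end of $j$ is the consecutive end of an end of $i$ around a vertex of $T$ (so a vertex of $T$ with only one end attached gives a loop of $Q_T$). The arrow from the first end of the loop to its second end is $\alpha_1\colon 1\to 1$; the remaining arrows around $S$ form the exceptional cycle $\beta_1\beta_2\cdots\beta_r$ with $\beta_j\colon j\to j+1$ for $j<r$ and $\beta_r\colon r\to 1$. Every vertex $i$ of $Q_T$ lies on exactly two cycles, one of them an $\alpha$-cycle and the other a $\beta$-cycle, where two distinct cycles that meet are of different kinds; $\alpha_i\colon i\to\alpha(i)$ and $\beta_i\colon i\to\beta(i)$ are the arrows of these cycles starting at $i$, and $A_i$, $B_i$ are the full turns around them starting at $i$. For $2\le j\le r$ put $B_j'=\beta_j\cdots\beta_r\alpha_1\beta_1\cdots\beta_{j-1}$.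 Let $\Omega(T)=KQ_T/J_T$ (paths are composed from left to right), where $J_T$ is the two-sided ideal generated by 1. $\beta_{\beta^{-1}(i)}\alpha_i$ and $\alpha_{\alpha^{-1}(i)}\beta_i$ for all vertices $i\neq 1$; 2. $\beta_r\beta_1$; 3. $A_i-B_i$ for all $i$ not on the exceptional cycle; 4. $A_j-B_j'$ for $2\le j\le r$; 5. $\alpha_1^2-\alpha_1\beta_1\cdots\beta_r$ and $\alpha_1\beta_1\cdots\beta_r+\beta_1\cdots\beta_r\alpha_1$. For an edge $z$ let $P(z)=\Omega(T)e_z$ be the corresponding projective left module. If $z\in\{1,\dots,r\}$, let $Q(z)$ be the complex $P(z)$ concentrated in degree $0$. If $z$ is any other edge, let $i\in\{2,\dots,r\}$ be the edge at $S$ such that $z$ lies in the tree attached to $T$ along $i$, let $i=z_0,z_1,\dots,z_m=z$ be the edges of the unique shortest path in $T$ from $i$ to $z$, and let $Q(z)$ be the complex $$0\to P(i)\to P(z_1)\to\cdots\to P(z_{m-1})\to P(z)\to 0$$ with $P(i)$ in degree $0$, where $P(z_j)\to P(z_{j+1})$ is right multiplication by the shortest path of $Q_T$ from $z_j$ to $z_{j+1}$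 around the vertex of $T$ shared by these two edges. Then all the maps $P(z_j)\to P(z_{j+1})$ in these complexes are non-zero, and $Q=\bigoplus_z Q(z)$, the sum over all edges $z$ of $T$, is a tilting complex for $\Omega(T)$. That is, $Q$ is a bounded complex of finitely generated projective $\Omega(T)$-modules; $\operatorname{Hom}(Q,Q[n])=0$ in the homotopy category for all $n\neq 0$; and $\operatorname{add}(Q)$ generates the homotopy category of bounded complexes of finitely generated projective $\Omega(T)$-modules as a triangulated category. -/

import Mathlib

open CategoryTheory CategoryTheory.Limits

/-! ### Brauer graphs with one loop -/

/-- A Brauer graph with vertex set `V` and edge set `E`: every edge `e` has the two ends `(e, false)`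
and `(e, true)`, each attached to a vertex, and `next` is the circular order of the ends around each
vertex (the orbits of `next` are exactly the sets of ends attached to a common vertex).  It is
required that the graph is connected and has exactly one cycle, which is a loop, and that the loop is
its own direct successor. -/
structure BrauerLoopGraph (V E : Type*) where
  /-- the vertex to which an end of an edge is attached -/
  vert : E × Bool → V
  /-- the circular order: the consecutive end around the same vertex -/
  next : Equiv.Perm (E × Bool)
  sameCycle_iff : ∀ x y, next.SameCycle x y ↔ vert x = vert y
  /-- the loop; its ends are labelled so that `(loop, true)` directly follows `(loop, false)` -/
  loop : E
  next_loop : next (loop, false) = (loop, true)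
  /-- there is no other loop, -/
  eq_loop : ∀ e, vert (e, false) = vert (e, true) → e = loop
  /-- there are no multiple edges, -/
  eq_of_ends : ∀ e e', s(vert (e, false), vert (e, true)) = s(vert (e', false), vert (e', true)) →
    e = e'
  /-- and the underlying simple graph is connected without cycles. -/
  isTree : (SimpleGraph.fromRel fun v w => ∃ e, vert (e, false) = v ∧ vert (e, true) = w).IsTree

namespace BrauerLoopGraph

variable {V E : Type*} (T : BrauerLoopGraph V E)

/-- The other end of the same edge. -/
def opp (x : E × Bool) : E × Bool := (x.1, !x.2)

/-- The vertex `S` of the loop. -/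
def center : V := T.vert (T.loop, false)

/-- The underlying simple graph (the tree that remains when the loop is deleted). -/
def graph : SimpleGraph V :=
  SimpleGraph.fromRel fun v w => ∃ e, T.vert (e, false) = v ∧ T.vert (e, true) = w

/-- The end of the edge `z` that has the larger distance from `S`, as a vertex. -/
noncomputable def farVertex (z : E) : V :=
  if T.graph.dist T.center (T.vert (z, false)) < T.graph.dist T.center (T.vert (z, true))
  then T.vert (z, true) else T.vert (z, false)

theorem exists_end_of_adj {v w : V} (h : T.graph.Adj v w) :
    ∃ x, T.vert x = v ∧ T.vert (opp x) = w := by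
  rcases h.2 with ⟨e, h1, h2⟩ | ⟨e, h1, h2⟩
  · exact ⟨(e, false), h1, h2⟩
  · exact ⟨(e, true), h2, h1⟩

/-- An edge of `T` traversed from `v` to `w` when these are adjacent, given by its end at `v`. -/
noncomputable def endOfAdj {v w : V} (h : T.graph.Adj v w) : E × Bool :=
  (T.exists_end_of_adj h).choose

theorem endOfAdj_spec {v w : V} (h : T.graph.Adj v w) :
    T.vert (T.endOfAdj h) = v ∧ T.vert (opp (T.endOfAdj h)) = w :=
  (T.exists_end_of_adj h).choose_spec

/-- The simple path in `T` from `S` to a vertex `v`. -/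
noncomputable def pathTo (v : V) : T.graph.Walk T.center v :=
  (T.isTree.existsUnique_path T.center v).choose

/-- The edge `z` corresponds to a vertex on the exceptional cycle, i.e. it is attached to `S`. -/
def IsExceptional (z : E) : Prop := ∃ b, T.vert (z, b) = T.center

open Classical in
/-- For `z` on the exceptional cycle, the list consisting of `z` only.  For any other `z`, the edges
`z₀, z₁, …, z_m = z` of the path in `T` which starts at `S`, passes through the edge `z₀` attached to
`S` and ends with the edge `z`.  Every edge `z_j` is recorded by its end closer to `S`. -/
noncomputable def route (z : E) : List (E × Bool) :=
  if T.IsExceptional z then [(z, false)]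
  else (T.pathTo (T.farVertex z)).darts.map fun d => T.endOfAdj d.adj

/-- Two edges, recorded by ends `x` and `y`, such that the second one is not the loop and starts at
the vertex where the first one ends. -/
def Follows (x y : E × Bool) : Prop := T.vert (opp x) = T.vert y ∧ y.1 ≠ T.loop

theorem vert_loop : T.vert (T.loop, false) = T.vert (T.loop, true) :=
  (T.sameCycle_iff _ _).1 ⟨1, by simpa using T.next_loop⟩

theorem isChain_route (z : E) : (T.route z).IsChain T.Follows := by
  unfold route
  split_ifs
  · exact List.isChain_singleton _
  · refine List.isChain_map_of_isChain _ ?_ (SimpleGraph.Walk.isChain_dartAdj_darts _)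
    intro d d' h
    have h1 := T.endOfAdj_spec d.adj
    have h2 := T.endOfAdj_spec d'.adj
    refine ⟨h1.2.trans (h.trans h2.1.symm), fun hl => d'.adj.ne (h2.1.symm.trans (.trans ?_ h2.2))⟩
    generalize T.endOfAdj d'.adj = x at hl
    obtain ⟨e, b⟩ := x
    obtain rfl : e = T.loop := hl
    cases b
    · exact T.vert_loop
    · exact T.vert_loop.symm

end BrauerLoopGraph

/-! ### Path algebras and the algebras `Ω(T)` -/

/-- The defining relations of the path algebra of a quiver with finite vertex set `I`, arrow set `A`,
and source and target maps `s, t`: the trivial paths are orthogonal idempotents with sum `1`, and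
`a = e_{s(a)} a = a e_{t(a)}` for every arrow `a` (paths are composed from left to right). -/
inductive PathAlgebra.Rel (K : Type*) [Field K] {I A : Type*} [Fintype I] (s t : A → I) :
    FreeAlgebra K (I ⊕ A) → FreeAlgebra K (I ⊕ A) → Prop
  | idem (i : I) : Rel K s t
      (FreeAlgebra.ι K (Sum.inl i) * FreeAlgebra.ι K (Sum.inl i)) (FreeAlgebra.ι K (Sum.inl i))
  | orth (i j : I) (h : i ≠ j) : Rel K s t
      (FreeAlgebra.ι K (Sum.inl i) * FreeAlgebra.ι K (Sum.inl j)) 0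
  | sum : Rel K s t (∑ i : I, FreeAlgebra.ι K (Sum.inl i)) 1
  | source (a : A) : Rel K s t
      (FreeAlgebra.ι K (Sum.inl (s a)) * FreeAlgebra.ι K (Sum.inr a)) (FreeAlgebra.ι K (Sum.inr a))
  | target (a : A) : Rel K s t
      (FreeAlgebra.ι K (Sum.inr a) * FreeAlgebra.ι K (Sum.inl (t a))) (FreeAlgebra.ι K (Sum.inr a))

/-- The path algebra over `K` of the quiver with vertices `I`, arrows `A`, source map `s` and target
map `t`. -/
def PathAlgebra (K : Type*) [Field K] {I A : Type*} [Fintype I] (s t : A → I) :=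
  RingQuot (PathAlgebra.Rel K s t)

namespace PathAlgebra

variable (K : Type*) [Field K] {I A : Type*} [Fintype I] (s t : A → I)

noncomputable instance : Ring (PathAlgebra K s t) :=
  inferInstanceAs (Ring (RingQuot (PathAlgebra.Rel K s t)))

noncomputable instance : Algebra K (PathAlgebra K s t) :=
  inferInstanceAs (Algebra K (RingQuot (PathAlgebra.Rel K s t)))

/-- The quotient map from the free algebra. -/
noncomputable def mk : FreeAlgebra K (I ⊕ A) →ₐ[K] PathAlgebra K s t :=
  RingQuot.mkAlgHom K (PathAlgebra.Rel K s t)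

/-- The trivial path at the vertex `i`. -/
noncomputable def triv (i : I) : PathAlgebra K s t := mk K s t (FreeAlgebra.ι K (Sum.inl i))

/-- The arrow `a`. -/
noncomputable def arrow (a : A) : PathAlgebra K s t := mk K s t (FreeAlgebra.ι K (Sum.inr a))

end PathAlgebra

namespace BrauerLoopGraph

variable (K : Type*) [Field K] {V E : Type*} [Fintype E] (T : BrauerLoopGraph V E)

/-- The path algebra `KQ_T` of the Brauer quiver: the vertices are the edges of `T`, and every end
`x` of an edge gives an arrow from its edge to the edge of the consecutive end. -/
abbrev QuiverAlgebra :=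
  PathAlgebra K (fun x : E × Bool => x.1) (fun x : E × Bool => (T.next x).1)

/-- The arrow of `Q_T` given by the end `x`. -/
noncomputable abbrev qArrow (x : E × Bool) : T.QuiverAlgebra K := PathAlgebra.arrow K _ _ x

/-- The path of length `k` in `Q_T` that starts with the arrow of the end `x` and turns around the
vertex of `x`. -/
noncomputable def qTurn (x : E × Bool) : ℕ → T.QuiverAlgebra K
  | 0 => PathAlgebra.triv K _ _ x.1
  | k + 1 => qTurn x k * T.qArrow K ((T.next ^ k) x)

/-- The full turn around the vertex of the end `x`, starting at `x`: the cycles `A_i`, `B_i` around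
the vertex `i = x.1` of `Q_T`.  If `x` is attached to `S` then the turn includes the arrow `α₁` of
the loop; in particular it is `B'_j` for an end at `S` of an edge `j ≠ 1`. -/
noncomputable def qCycle (x : E × Bool) : T.QuiverAlgebra K :=
  T.qTurn K x (Function.minimalPeriod T.next x)

/-- The generators of the ideal `J_T`.  Here `1` is the loop, `α₁` is the arrow of `(loop, false)` and
`β₁` is the arrow of `(loop, true)`. For a vertex `i ≠ 1` of `Q_T`, one of the two ends of `i` gives
the arrow `α_i` and the other one gives `β_i`, and the arrow which precedes that of the end `x` in its
cycle is the arrow of `T.next⁻¹ x`. -/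
inductive IsRelator : T.QuiverAlgebra K → Prop
  /-- `β_{β⁻¹(i)} α_i` and `α_{α⁻¹(i)} β_i` for `i ≠ 1` -/
  | change (x : E × Bool) (hx : x.1 ≠ T.loop) :
      IsRelator (T.qArrow K (T.next⁻¹ x) * T.qArrow K (opp x))
  /-- `β_r β₁` -/
  | exceptional : IsRelator (T.qArrow K (T.next⁻¹ (T.loop, false)) * T.qArrow K (T.loop, true))
  /-- `A_i - B_i` for `i` not on the exceptional cycle, `A_j - B'_j` for `j ≠ 1` on it -/
  | cycle (x : E × Bool) (hx : x.1 ≠ T.loop) : IsRelator (T.qCycle K x - T.qCycle K (opp x))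
  /-- `α₁² - α₁ β₁ ⋯ β_r` -/
  | square : IsRelator (T.qArrow K (T.loop, false) ^ 2 - T.qCycle K (T.loop, false))
  /-- `α₁ β₁ ⋯ β_r + β₁ ⋯ β_r α₁` -/
  | anti : IsRelator (T.qCycle K (T.loop, false) + T.qCycle K (T.loop, true))

/-- The algebra `Ω(T) = KQ_T / J_T`. -/
def Omega := RingQuot fun a b : T.QuiverAlgebra K => T.IsRelator K a ∧ b = 0

noncomputable instance : Ring (T.Omega K) :=
  inferInstanceAs (Ring (RingQuot fun a b : T.QuiverAlgebra K => T.IsRelator K a ∧ b = 0))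

noncomputable instance : Algebra K (T.Omega K) :=
  inferInstanceAs (Algebra K (RingQuot fun a b : T.QuiverAlgebra K => T.IsRelator K a ∧ b = 0))

/-- The quotient map `KQ_T → Ω(T)`. -/
noncomputable def toOmega : T.QuiverAlgebra K →ₐ[K] T.Omega K :=
  RingQuot.mkAlgHom K (fun a b : T.QuiverAlgebra K => T.IsRelator K a ∧ b = 0)

theorem toOmega_eq_zero {a : T.QuiverAlgebra K} (h : T.IsRelator K a) : T.toOmega K a = 0 :=
  (RingQuot.mkAlgHom_rel K (s := fun a b : T.QuiverAlgebra K => T.IsRelator K a ∧ b = 0)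
    ⟨h, rfl⟩).trans (map_zero (T.toOmega K))

/-- The idempotent of `Ω(T)` at the edge `z`. -/
noncomputable def idem (z : E) : T.Omega K := T.toOmega K (PathAlgebra.triv K _ _ z)

/-! ### The complexes `Q(z)` -/

/-- The projective left module `P(z) = Ω(T) e_z`. -/
noncomputable abbrev proj (z : E) : Submodule (T.Omega K) (T.Omega K) :=
  Submodule.span (T.Omega K) {T.idem K z}

/-- Right multiplication `P(y) → P(z)`, `p ↦ p (a e_z)`, by an element `a e_z`. -/
noncomputable def rightMul (y z : E) (a : T.Omega K) : T.proj K y →ₗ[T.Omega K] T.proj K z :=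
  ((LinearMap.toSpanSingleton (T.Omega K) (T.Omega K) (a * T.idem K z)).domRestrict
    (T.proj K y)).codRestrict (T.proj K z) fun _ =>
      Submodule.smul_mem _ _ (Submodule.smul_mem _ a (Submodule.mem_span_singleton_self _))

/-- The number of steps (at least one) of `next` from the end `x` to the end `y`. -/
noncomputable def steps (x y : E × Bool) : ℕ := sInf {k | (T.next ^ (k + 1)) x = y} + 1

/-- For edges recorded by ends `x` and `y`, the second starting where the first one ends: the image in
`Ω(T)` of the shortest path in `Q_T` from `x.1` to `y.1`, around their common vertex. -/
noncomputable def link (x y : E × Bool) : T.Omega K :=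
  T.toOmega K (T.qTurn K (opp x) (T.steps (opp x) y))

/-- The term of a complex `Q(z)` for an optional edge, recorded by one of its ends. -/
noncomputable def term : Option (E × Bool) → ModuleCat (T.Omega K)
  | none => ModuleCat.of _ PUnit
  | some x => ModuleCat.of _ (T.proj K x.1)

/-- The differential between such terms: right multiplication by the path in `Q_T`. -/
noncomputable def termMap : ∀ o o' : Option (E × Bool), T.term K o ⟶ T.term K o'
  | some x, some y => ModuleCat.ofHom (T.rightMul K x.1 y.1 (T.link K x y))
  | some _, none => 0
  | none, some _ => 0
  | none, none => 0

/-- The entry of a list at an integer position, if there is one. -/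
def entry (l : List (E × Bool)) (n : ℤ) : Option (E × Bool) := if 0 ≤ n then l[n.toNat]? else none

theorem qTurn_succ_right (x : E × Bool) (k : ℕ) :
    ∃ b, T.qTurn K x (k + 1) = T.qArrow K x * b := by
  induction k with
  | zero =>
    refine ⟨1, ?_⟩
    rw [mul_one]
    have := RingQuot.mkAlgHom_rel K (PathAlgebra.Rel.source (K := K)
      (s := fun x : E × Bool => x.1) (t := fun x : E × Bool => (T.next x).1) x)
    rw [map_mul] at this
    exact this
  | succ k ih =>
    obtain ⟨b, hb⟩ := ih
    exact ⟨b * T.qArrow K ((T.next ^ (k + 1)) x), by rw [qTurn, hb, mul_assoc]⟩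

theorem qTurn_mul_idem (x : E × Bool) (k : ℕ) :
    T.qTurn K x (k + 1) * PathAlgebra.triv K _ _ ((T.next ^ (k + 1)) x).1 = T.qTurn K x (k + 1) := by
  have := RingQuot.mkAlgHom_rel K (PathAlgebra.Rel.target (K := K)
    (s := fun x : E × Bool => x.1) (t := fun x : E × Bool => (T.next x).1) ((T.next ^ k) x))
  rw [map_mul] at this
  rw [qTurn, mul_assoc, pow_succ' T.next k]
  exact congrArg (T.qTurn K x k * ·) this

theorem next_pow_steps {x y : E × Bool} (h : T.vert x = T.vert y) :
    (T.next ^ T.steps x y) x = y := by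
  obtain ⟨k, hk, -, h'⟩ := ((T.sameCycle_iff x y).2 h).exists_pow_eq''
  exact Nat.sInf_mem (s := {k | (T.next ^ (k + 1)) x = y})
    ⟨k - 1, by rwa [Set.mem_ofPred_eq, Nat.sub_add_cancel hk]⟩

theorem link_mul_link {x y z : E × Bool} (hxy : T.Follows x y) :
    T.link K x y * T.idem K y.1 * T.link K y z = 0 := by
  have hs : (T.next ^ T.steps (opp x) y) (opp x) = y := T.next_pow_steps hxy.1
  obtain ⟨b, hb⟩ := T.qTurn_succ_right K (opp y) (sInf {k | (T.next ^ (k + 1)) (opp y) = z})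
  unfold link idem steps at *
  set k := sInf {k | (T.next ^ (k + 1)) (opp x) = y}
  have h1 := T.qTurn_mul_idem K (opp x) k
  rw [hs] at h1
  have h2 : (T.next ^ k) (opp x) = T.next⁻¹ y := by
    rw [← hs, pow_succ', Equiv.Perm.mul_apply]; simp
  rw [← map_mul, h1, hb, qTurn, h2, map_mul, map_mul, mul_assoc,
    ← mul_assoc (T.toOmega K (T.qArrow K (T.next⁻¹ y))), ← map_mul (T.toOmega K) (T.qArrow K _),
    T.toOmega_eq_zero K (.change y hxy.2), zero_mul, mul_zero]

theorem termMap_comp_zero {x y z : E × Bool} (hxy : T.Follows x y) :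
    T.termMap K (some x) (some y) ≫ T.termMap K (some y) (some z) = 0 := by
  ext p
  apply Subtype.ext
  change (p.1 * (T.link K x y * T.idem K y.1)) * (T.link K y z * T.idem K z.1) = 0
  rw [mul_assoc, ← mul_assoc _ (T.link K y z), T.link_mul_link K hxy, zero_mul, mul_zero]

theorem termMap_entry_comp {l : List (E × Bool)} (hl : l.IsChain T.Follows) (n : ℤ) :
    T.termMap K (entry l n) (entry l (n + 1)) ≫
      T.termMap K (entry l (n + 1)) (entry l (n + 1 + 1)) = 0 := by
  have key : ∀ o o' o'' : Option (E × Bool),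
      (∀ x y, o = some x → o' = some y → T.Follows x y) →
      T.termMap K o o' ≫ T.termMap K o' o'' = 0 := by
    intro o o' o'' h
    rcases o with _ | x <;> rcases o' with _ | y
    · exact zero_comp
    · exact zero_comp
    · exact zero_comp
    · rcases o'' with _ | z
      · exact comp_zero
      · exact T.termMap_comp_zero K (h x y rfl rfl)
  refine key _ _ _ fun x y hx hy => ?_
  unfold entry at hx hy
  split_ifs at hx hy with h0 h1
  obtain ⟨k, rfl⟩ := Int.eq_ofNat_of_zero_le h0
  have e : ((k : ℤ) + 1).toNat = k + 1 := by omega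
  rw [e] at hy
  rw [Int.toNat_natCast] at hx
  obtain ⟨hk, rfl⟩ := List.getElem?_eq_some_iff.1 hx
  obtain ⟨hk', rfl⟩ := List.getElem?_eq_some_iff.1 hy
  exact List.isChain_iff_getElem.1 hl k hk'

/-- The complex `P(z₀) → P(z₁) → ⋯ → P(z_m)`, with `P(z₀)` in degree `0`, for a list of consecutive
edges of `T`. -/
noncomputable def pathComplex (l : List (E × Bool)) (hl : l.IsChain T.Follows) :
    CochainComplex (ModuleCat (T.Omega K)) ℤ :=
  CochainComplex.of (fun n => T.term K (entry l n)) (fun n => T.termMap K (entry l n) (entry l (n + 1)))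
    (T.termMap_entry_comp K hl)

/-- The complex `Q(z)`: the stalk complex `P(z)` in degree `0` if `z` is on the exceptional cycle, and
`P(z₀) → P(z₁) → ⋯ → P(z)` otherwise. -/
noncomputable def rickardComplex (z : E) : CochainComplex (ModuleCat (T.Omega K)) ℤ :=
  T.pathComplex K (T.route z) (T.isChain_route z)

end BrauerLoopGraph

/-! ### Tilting complexes -/

section Tilting

universe w v

variable {A : Type v} [Ring A]

instance : HasFiniteBiproducts (CochainComplex (ModuleCat.{w} A) ℤ) :=
  Abelian.hasFiniteBiproducts

/-- Bounded complexes of finitely generated projective `A`-modules. -/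
def IsBoundedProjective (C : CochainComplex (ModuleCat.{w} A) ℤ) : Prop :=
  (∀ n, Module.Finite A (C.X n) ∧ Module.Projective A (C.X n)) ∧
    ∃ a b : ℤ, ∀ n, n < a ∨ b < n → IsZero (C.X n)

/-- The homotopy category of complexes of `A`-modules. -/
abbrev HoCat (A : Type v) [Ring A] := HomotopyCategory (ModuleCat.{w} A) (ComplexShape.up ℤ)

/-- A complex as an object of the homotopy category. -/
noncomputable abbrev toHo (C : CochainComplex (ModuleCat.{w} A) ℤ) : HoCat.{w} A :=
  (HomotopyCategory.quotient (ModuleCat.{w} A) (ComplexShape.up ℤ)).obj C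

/-- `Q` is a tilting complex for `A`: a bounded complex of finitely generated projective modules with
`Hom(Q, Q[n]) = 0` up to homotopy for `n ≠ 0`, such that `add(Q)` (the direct summands of finite
direct sums of copies of `Q`) generates the homotopy category of all such complexes as a triangulated
category: every strictly full triangulated subcategory which contains `add(Q)` contains all bounded
complexes of finitely generated projective modules. -/
def IsTiltingComplex (Q : CochainComplex (ModuleCat.{w} A) ℤ) : Prop :=
  IsBoundedProjective Q ∧
  (∀ n : ℤ, n ≠ 0 → ∀ f : toHo Q ⟶ (toHo Q)⟦n⟧, f = 0) ∧
  ∀ S : ObjectProperty (HoCat.{w} A), S.IsTriangulated → S.IsClosedUnderIsomorphisms →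
    (∀ (X : HoCat.{w} A) (k : ℕ), Nonempty (Retract X (⨁ fun _ : Fin k => toHo Q)) → S X) →
    ∀ C : CochainComplex (ModuleCat.{w} A) ℤ, IsBoundedProjective C → S (toHo C)

end Tilting

/-!
The proof is elementary. It works with the multiplication of paths in `Ω(T)` and does not use tilting
theory.

*The algebra.* By the relations, `Ω(T)` is spanned by the turns, i.e. the paths which turn around a
single vertex of `T`, and turns that are longer than a full turn vanish (`turn_eq_zero`); so `Ω(T)` is
finite-dimensional and the turns of positive length span a nilpotent ideal (`turnSpan_eq_bot`). Hence
`Hom(P(y), P(z)) = e_y Ω(T) e_z` is zero if the edges `y` and `z` have no common vertex, and it is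
spanned by the shortest turn from `y` to `z` if they are different, neither is the loop, and they
share one vertex. On the other hand the full turns at an edge `i ≠ 1` do not vanish
(`turn_valency_ne_zero`): the functions on the paths starting at `i` which agree on the two full turns
form a module on which they act nontrivially. So the shortest paths between consecutive edges are
nonzero, and so are their products with the shortest paths back.

*No morphisms between shifts.* The term of degree `j` of `Q(z)` belongs to an edge at distance `j`
from `S` in the tree that remains when the loop is deleted. Edges with a common vertex have distances
which differ by at most one, and an edge has at most one neighbour which is closer to `S`
(`parent_unique`). So there are no cochains of degree `n` between `Q(z)` and `Q(w)` if `|n| ≥ 2`. A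
cocycle of degree `-1` vanishes, by induction on the degree of its components: a component is a
multiple of a shortest path, and its product with the differential is the same multiple of a full
turn. A cochain of degree `1` consists of multiples `c_j` of the differential on the common part of
`Q(z)` and `Q(w)`, and it is the coboundary of the multiplication by `∑_{k ≥ j} c_k` in degree `j`
(`cocycle_mem_coboundaries`).

*Generation.* The terms of `Q(z)` are `P(z)` in the last degree, and modules `P(y)` with `y` closer to
`S` in the other degrees. By induction on the distance from `S`, a triangulated subcategory which
contains all `Q(z)` contains all `P(z)` (`stalkProp_proj`). As the rings `e_z Ω(T) e_z` are local, every
finitely generated projective module is built from the `P(z)` by split extensions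
(`projective_induction`), and a bounded complex is built from its terms by degreewise split
extensions (`prop_toHo_of_stalkProp`).
-/

/-! ### Turns around a vertex -/

namespace BrauerLoopGraph

section Order

variable {V E : Type*} (T : BrauerLoopGraph V E)

/-- The number of ends attached to the vertex of the end `x`. -/
noncomputable def valency (x : E × Bool) : ℕ := Function.minimalPeriod T.next x

theorem opp_opp (x : E × Bool) : opp (opp x) = x := by simp [opp]

theorem opp_ne (x : E × Bool) : opp x ≠ x := fun h => by
  simpa [opp] using congrArg Prod.snd h

theorem eq_or_eq_opp {x y : E × Bool} (h : x.1 = y.1) : x = y ∨ x = opp y := by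
  obtain ⟨a, b⟩ := x
  obtain ⟨c, d⟩ := y
  obtain rfl : a = c := h
  cases b <;> cases d <;> simp [opp]

theorem next_pow_eq_self_iff (x : E × Bool) (k : ℕ) : (T.next ^ k) x = x ↔ T.valency x ∣ k := by
  rw [valency, ← Function.isPeriodicPt_iff_minimalPeriod_dvd, Function.IsPeriodicPt,
    Function.IsFixedPt, Equiv.Perm.iterate_eq_pow]

theorem next_pow_valency (x : E × Bool) : (T.next ^ T.valency x) x = x :=
  (T.next_pow_eq_self_iff x _).2 dvd_rfl

theorem vert_next_pow (x : E × Bool) (k : ℕ) : T.vert ((T.next ^ k) x) = T.vert x :=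
  ((T.sameCycle_iff _ _).1 ⟨k, by simp⟩).symm

theorem steps_pos (x y : E × Bool) : 0 < T.steps x y := Nat.succ_pos _

theorem steps_le {x y : E × Bool} {k : ℕ} (hk : 0 < k) (h : (T.next ^ k) x = y) :
    T.steps x y ≤ k := by
  have : sInf {k | (T.next ^ (k + 1)) x = y} ≤ k - 1 :=
    Nat.sInf_le (by rwa [Set.mem_ofPred_eq, Nat.sub_add_cancel hk])
  unfold steps
  omega

variable [Fintype E]

theorem mem_periodicPts (x : E × Bool) : x ∈ Function.periodicPts T.next :=
  T.next.injective.mem_periodicPts x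

theorem valency_pos (x : E × Bool) : 0 < T.valency x :=
  Function.minimalPeriod_pos_of_mem_periodicPts (T.mem_periodicPts x)

theorem valency_next_pow (x : E × Bool) (k : ℕ) : T.valency ((T.next ^ k) x) = T.valency x := by
  rw [valency, ← Equiv.Perm.iterate_eq_pow,
    Function.minimalPeriod_apply_iterate (T.mem_periodicPts x), valency]

theorem valency_eq_of_vert_eq {x y : E × Bool} (h : T.vert x = T.vert y) :
    T.valency x = T.valency y := by
  rw [← T.next_pow_steps h, valency_next_pow]

theorem valency_le_card (x : E × Bool) : T.valency x ≤ Fintype.card (E × Bool) :=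
  Function.minimalPeriod_le_card

theorem one_lt_valency {x y : E × Bool} (h : T.vert x = T.vert y) (hxy : x ≠ y) :
    1 < T.valency x := by
  by_contra hlt
  have h1 : T.valency x = 1 := le_antisymm (not_lt.1 hlt) (T.valency_pos x)
  refine hxy ?_
  rw [← T.next_pow_steps h, eq_comm, next_pow_eq_self_iff, h1]
  exact one_dvd _

theorem steps_lt {x y : E × Bool} (h : T.vert x = T.vert y) (hxy : x ≠ y) :
    T.steps x y < T.valency x := by
  have hk := T.next_pow_steps h
  rw [← Equiv.Perm.iterate_eq_pow, ← Function.iterate_mod_minimalPeriod_eq,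
    Equiv.Perm.iterate_eq_pow] at hk
  refine (T.steps_le (Nat.pos_of_ne_zero fun h0 => hxy ?_) hk).trans_lt
    (Nat.mod_lt _ (T.valency_pos x))
  rwa [h0] at hk

theorem steps_add_steps {x y : E × Bool} (h : T.vert x = T.vert y) (hxy : x ≠ y) :
    T.steps x y + T.steps y x = T.valency x := by
  have h1 := T.steps_lt h hxy
  have h2 := T.steps_lt h.symm hxy.symm
  rw [← T.valency_eq_of_vert_eq h] at h2
  have h3 : T.valency x ∣ T.steps y x + T.steps x y := by
    rw [← next_pow_eq_self_iff, pow_add, Equiv.Perm.mul_apply, T.next_pow_steps h,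
      T.next_pow_steps h.symm]
  obtain ⟨c, hc⟩ := h3
  have h4 := T.steps_pos x y
  obtain rfl : c = 1 := by
    rcases c with _ | _ | c
    · omega
    · rfl
    · nlinarith
  omega

/-- Any way of turning from `x` to `y` other than the shortest one is longer than a full turn. -/
theorem eq_steps_or_lt {x y : E × Bool} {k : ℕ} (hk : 0 < k) (h : (T.next ^ k) x = y) :
    k = T.steps x y ∨ T.valency x < k := by
  have hv : T.vert x = T.vert y := by rw [← h, vert_next_pow]
  have hle := T.steps_le hk h
  obtain ⟨j, rfl⟩ := Nat.exists_eq_add_of_le' hle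
  rw [pow_add, Equiv.Perm.mul_apply, T.next_pow_steps hv, next_pow_eq_self_iff,
    ← T.valency_eq_of_vert_eq hv] at h
  rcases Nat.eq_zero_or_pos j with rfl | hj
  · exact .inl (zero_add _)
  · have := Nat.le_of_dvd hj h
    have := T.steps_pos x y
    omega

end Order

/-! ### Multiplication of turns in `Ω(T)` -/

variable (K : Type*) [Field K] {V E : Type*} [Fintype E] (T : BrauerLoopGraph V E)

/-- The image in `Ω(T)` of the arrow of the end `x`. -/
noncomputable def arr (x : E × Bool) : T.Omega K := T.toOmega K (T.qArrow K x)

/-- The image in `Ω(T)` of the path of length `k` which starts with the arrow of the end `x` and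
turns around the vertex of `x`. -/
noncomputable def turn (x : E × Bool) (k : ℕ) : T.Omega K := T.toOmega K (T.qTurn K x k)

theorem link_eq (x y : E × Bool) : T.link K x y = T.turn K (opp x) (T.steps (opp x) y) := rfl

theorem idem_mul_self (z : E) : T.idem K z * T.idem K z = T.idem K z := by
  have := RingQuot.mkAlgHom_rel K (PathAlgebra.Rel.idem (K := K)
    (s := fun x : E × Bool => x.1) (t := fun x : E × Bool => (T.next x).1) z)
  rw [map_mul] at this
  unfold idem
  rw [← map_mul]
  exact congrArg (T.toOmega K) this

theorem idem_mul_of_ne {y z : E} (h : y ≠ z) : T.idem K y * T.idem K z = 0 := by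
  have := RingQuot.mkAlgHom_rel K (PathAlgebra.Rel.orth (K := K)
    (s := fun x : E × Bool => x.1) (t := fun x : E × Bool => (T.next x).1) y z h)
  rw [map_mul, map_zero] at this
  unfold idem
  rw [← map_mul, ← map_zero (T.toOmega K)]
  exact congrArg (T.toOmega K) this

theorem sum_idem : ∑ z, T.idem K z = 1 := by
  have := RingQuot.mkAlgHom_rel K (PathAlgebra.Rel.sum (K := K)
    (s := fun x : E × Bool => x.1) (t := fun x : E × Bool => (T.next x).1))
  rw [map_sum, map_one] at this
  unfold idem
  rw [← map_sum, ← map_one (T.toOmega K)]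
  exact congrArg (T.toOmega K) this

theorem idem_mul_arr (x : E × Bool) : T.idem K x.1 * T.arr K x = T.arr K x := by
  have := RingQuot.mkAlgHom_rel K (PathAlgebra.Rel.source (K := K)
    (s := fun x : E × Bool => x.1) (t := fun x : E × Bool => (T.next x).1) x)
  rw [map_mul] at this
  unfold idem arr
  rw [← map_mul]
  exact congrArg (T.toOmega K) this

theorem arr_mul_idem (x : E × Bool) : T.arr K x * T.idem K (T.next x).1 = T.arr K x := by
  have := RingQuot.mkAlgHom_rel K (PathAlgebra.Rel.target (K := K)
    (s := fun x : E × Bool => x.1) (t := fun x : E × Bool => (T.next x).1) x)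
  rw [map_mul] at this
  unfold idem arr
  rw [← map_mul]
  exact congrArg (T.toOmega K) this

theorem turn_zero (x : E × Bool) : T.turn K x 0 = T.idem K x.1 := rfl

theorem turn_succ (x : E × Bool) (k : ℕ) :
    T.turn K x (k + 1) = T.turn K x k * T.arr K ((T.next ^ k) x) := map_mul _ _ _

theorem turn_one (x : E × Bool) : T.turn K x 1 = T.arr K x := by
  rw [turn_succ, turn_zero, pow_zero, Equiv.Perm.one_apply, idem_mul_arr]

theorem turn_mul_idem (x : E × Bool) (k : ℕ) :
    T.turn K x k * T.idem K ((T.next ^ k) x).1 = T.turn K x k := by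
  cases k with
  | zero => exact T.idem_mul_self K x.1
  | succ k => rw [turn_succ, pow_succ', mul_assoc, Equiv.Perm.mul_apply, arr_mul_idem]

theorem turn_add (x : E × Bool) (j k : ℕ) :
    T.turn K x (j + k) = T.turn K x j * T.turn K ((T.next ^ j) x) k := by
  induction k with
  | zero => rw [turn_zero, turn_mul_idem, add_zero]
  | succ k ih =>
    rw [← add_assoc, turn_succ, ih, turn_succ, mul_assoc, ← Equiv.Perm.mul_apply, ← pow_add,
      add_comm k j]

theorem idem_mul_turn (x : E × Bool) (k : ℕ) : T.idem K x.1 * T.turn K x k = T.turn K x k := by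
  have := T.turn_add K x 0 k
  rwa [zero_add, turn_zero, pow_zero, Equiv.Perm.one_apply, eq_comm] at this

theorem turn_succ' (x : E × Bool) (k : ℕ) :
    T.turn K x (k + 1) = T.arr K x * T.turn K (T.next x) k := by
  rw [add_comm, turn_add, turn_one, pow_one]

theorem idem_mul_turn_of_ne {z : E} {x : E × Bool} (h : z ≠ x.1) (k : ℕ) :
    T.idem K z * T.turn K x k = 0 := by
  rw [← idem_mul_turn, ← mul_assoc, T.idem_mul_of_ne K h, zero_mul]

theorem turn_mul_idem_of_ne {z : E} {x : E × Bool} {k : ℕ} (h : ((T.next ^ k) x).1 ≠ z) :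
    T.turn K x k * T.idem K z = 0 := by
  rw [← turn_mul_idem, mul_assoc, T.idem_mul_of_ne K h, mul_zero]

/-- In `Ω(T)` two arrows compose to zero unless they are consecutive around a vertex, with the
exception of the square of the arrow of the loop. -/
theorem arr_mul_arr_eq_zero {x y : E × Bool} (h : y ≠ T.next x)
    (hl : ¬ (x = (T.loop, false) ∧ y = (T.loop, false))) : T.arr K x * T.arr K y = 0 := by
  by_cases h1 : y.1 = (T.next x).1
  · obtain rfl := (eq_or_eq_opp h1).resolve_left h
    obtain ⟨w, rfl⟩ : ∃ w, x = T.next⁻¹ w := ⟨T.next x, by simp⟩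
    rw [show T.next (T.next⁻¹ w) = w by simp] at hl ⊢
    by_cases h2 : w.1 = T.loop
    · obtain ⟨e, b⟩ := w
      obtain rfl : e = T.loop := h2
      cases b
      · have := T.toOmega_eq_zero K .exceptional
        rwa [map_mul] at this
      · exact absurd ⟨by simp [← T.next_loop], rfl⟩ hl
    · have := T.toOmega_eq_zero K (.change w h2)
      rwa [map_mul] at this
  · rw [← arr_mul_idem, mul_assoc, ← T.idem_mul_arr K y, ← mul_assoc (T.idem K _),
      T.idem_mul_of_ne K (Ne.symm h1), zero_mul, mul_zero]

theorem arr_loop_sq : T.arr K (T.loop, false) * T.arr K (T.loop, false) =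
    T.turn K (T.loop, false) (T.valency (T.loop, false)) := by
  have := T.toOmega_eq_zero K .square
  rw [map_sub, sub_eq_zero, map_pow, sq] at this
  exact this

theorem turn_loop_anti : T.turn K (T.loop, false) (T.valency (T.loop, false)) =
    - T.turn K (T.loop, true) (T.valency (T.loop, true)) := by
  have := T.toOmega_eq_zero K .anti
  rw [map_add] at this
  exact eq_neg_of_add_eq_zero_left this

theorem turn_valency_opp {x : E × Bool} (hx : x.1 ≠ T.loop) :
    T.turn K x (T.valency x) = T.turn K (opp x) (T.valency (opp x)) := by
  have := T.toOmega_eq_zero K (.cycle x hx)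
  rw [map_sub, sub_eq_zero] at this
  exact this

theorem turn_valency_add_one (x : E × Bool) :
    T.turn K x (T.valency x + 1) = T.turn K x (T.valency x) * T.arr K x := by
  rw [turn_succ, next_pow_valency]

/-- The last arrow of a full turn. -/
theorem exists_turn_valency_eq (x : E × Bool) :
    ∃ w, T.next w = x ∧ T.turn K x (T.valency x) = T.turn K x (T.valency x - 1) * T.arr K w := by
  have hpos := T.valency_pos x
  refine ⟨(T.next ^ (T.valency x - 1)) x, ?_, ?_⟩
  · rw [← Equiv.Perm.mul_apply, ← pow_succ', Nat.sub_add_cancel hpos, next_pow_valency]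
  · rw [← turn_succ, Nat.sub_add_cancel hpos]

/-- A path that is longer than a full turn around a vertex vanishes in `Ω(T)`. -/
theorem turn_eq_zero {x : E × Bool} {k : ℕ} (h : T.valency x < k) : T.turn K x k = 0 := by
  suffices h0 : ∀ x, T.turn K x (T.valency x + 1) = 0 by
    obtain ⟨j, rfl⟩ := Nat.exists_eq_add_of_le h
    rw [turn_add, h0, zero_mul]
  clear h x
  have hltrue : T.turn K (T.loop, true) (T.valency (T.loop, true) + 1) = 0 := by
    obtain ⟨w, hw, hw'⟩ := T.exists_turn_valency_eq K (T.loop, false)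
    rw [turn_valency_add_one, ← neg_neg (T.turn K (T.loop, true) _), ← turn_loop_anti, hw',
      neg_mul, mul_assoc, T.arr_mul_arr_eq_zero K, mul_zero, neg_zero]
    · rw [hw]
      simp
    · simp
  intro x
  rw [turn_valency_add_one]
  by_cases hx : x.1 = T.loop
  · obtain ⟨e, b⟩ := x
    obtain rfl : e = T.loop := hx
    cases b
    · -- `α₁² = α₁ β₁ ⋯ β_r` turns a product with `α₁` into a path starting with `β₁`.
      obtain ⟨w, hw, hw'⟩ := T.exists_turn_valency_eq K (T.loop, true)
      obtain rfl : w = (T.loop, false) := T.next.injective (hw.trans T.next_loop.symm)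
      have h1 : 1 < T.valency (T.loop, true) := T.one_lt_valency T.vert_loop.symm (by simp)
      have hfix : (T.next ^ (T.valency (T.loop, true) - 1)) (T.loop, true) = (T.loop, false) := by
        apply T.next.injective
        rw [hw, ← Equiv.Perm.mul_apply, ← pow_succ', Nat.sub_add_cancel h1.le, next_pow_valency]
      rw [turn_loop_anti, neg_mul, hw', mul_assoc, arr_loop_sq, T.valency_eq_of_vert_eq T.vert_loop]
      have hadd := T.turn_add K (T.loop, true) (T.valency (T.loop, true) - 1)
        (T.valency (T.loop, true))
      rw [hfix] at hadd
      obtain ⟨j, hj⟩ : ∃ j, T.valency (T.loop, true) - 1 + T.valency (T.loop, true) =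
        T.valency (T.loop, true) + 1 + j := ⟨T.valency (T.loop, true) - 2, by omega⟩
      rw [← hadd, hj, turn_add, hltrue, zero_mul, neg_zero]
    · rw [← turn_valency_add_one, hltrue]
  · obtain ⟨w, hw, hw'⟩ := T.exists_turn_valency_eq K (opp x)
    rw [T.turn_valency_opp K hx, hw', mul_assoc, T.arr_mul_arr_eq_zero K, mul_zero]
    · rw [hw]
      exact (opp_ne x).symm
    · rintro ⟨-, rfl⟩
      exact hx rfl

/-! ### The filtration of `Ω(T)` by the length of paths -/

/-- The span of the turns of length at least `N`. -/
noncomputable def turnSpan (N : ℕ) : Submodule K (T.Omega K) :=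
  Submodule.span K {a | ∃ x k, N ≤ k ∧ a = T.turn K x k}

theorem turn_mem_turnSpan {x : E × Bool} {N k : ℕ} (h : N ≤ k) : T.turn K x k ∈ T.turnSpan K N :=
  Submodule.subset_span ⟨x, k, h, rfl⟩

theorem turnSpan_anti {M N : ℕ} (h : M ≤ N) : T.turnSpan K N ≤ T.turnSpan K M :=
  Submodule.span_mono fun _ ⟨x, k, hk, e⟩ => ⟨x, k, h.trans hk, e⟩

theorem mul_idem_mem_turnSpan {N : ℕ} {a : T.Omega K} (ha : a ∈ T.turnSpan K N) (z : E) :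
    a * T.idem K z ∈ T.turnSpan K N := by
  induction ha using Submodule.span_induction with
  | mem a h =>
    obtain ⟨x, k, hk, rfl⟩ := h
    by_cases hz : ((T.next ^ k) x).1 = z
    · rw [← hz, turn_mul_idem]
      exact T.turn_mem_turnSpan K hk
    · rw [T.turn_mul_idem_of_ne K hz]
      exact zero_mem _
  | zero => rw [zero_mul]; exact zero_mem _
  | add a b _ _ ha hb => rw [add_mul]; exact add_mem ha hb
  | smul c a _ ha => rw [smul_mul_assoc]; exact Submodule.smul_mem _ _ ha

theorem mul_arr_mem_turnSpan {N : ℕ} {a : T.Omega K} (ha : a ∈ T.turnSpan K N) (y : E × Bool) :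
    a * T.arr K y ∈ T.turnSpan K (N + 1) := by
  induction ha using Submodule.span_induction with
  | mem a h =>
    obtain ⟨x, k, hk, rfl⟩ := h
    by_cases hy : y = (T.next ^ k) x
    · rw [hy, ← turn_succ]
      exact T.turn_mem_turnSpan K (by omega)
    · cases k with
      | zero =>
        by_cases hxy : x.1 = y.1
        · rw [turn_zero, hxy, idem_mul_arr, ← turn_one]
          exact T.turn_mem_turnSpan K (by omega)
        · rw [← idem_mul_arr, ← mul_assoc, turn_zero, T.idem_mul_of_ne K hxy, zero_mul]
          exact zero_mem _
      | succ k =>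
        rw [turn_succ, mul_assoc]
        by_cases hl : (T.next ^ k) x = (T.loop, false) ∧ y = (T.loop, false)
        · have h1 := T.one_lt_valency T.vert_loop (by simp)
          nth_rw 1 [hl.1]
          rw [hl.2, arr_loop_sq]
          nth_rw 1 [← hl.1]
          rw [← turn_add]
          exact T.turn_mem_turnSpan K (by omega)
        · rw [T.arr_mul_arr_eq_zero K _ hl, mul_zero]
          · exact zero_mem _
          · rwa [pow_succ', Equiv.Perm.mul_apply] at hy
  | zero => rw [zero_mul]; exact zero_mem _
  | add a b _ _ ha hb => rw [add_mul]; exact add_mem ha hb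
  | smul c a _ ha => rw [smul_mul_assoc]; exact Submodule.smul_mem _ _ ha

theorem mul_mem_turnSpan {N : ℕ} {a : T.Omega K} (ha : a ∈ T.turnSpan K N) (b : T.Omega K) :
    a * b ∈ T.turnSpan K N := by
  obtain ⟨b, rfl⟩ := RingQuot.mkAlgHom_surjective K _ b
  obtain ⟨b, rfl⟩ := RingQuot.mkAlgHom_surjective K _ b
  change a * T.toOmega K (PathAlgebra.mk K _ _ b) ∈ _
  induction b using FreeAlgebra.induction generalizing a with
  | grade0 r =>
    rw [AlgHom.commutes, AlgHom.commutes, ← Algebra.commutes, ← Algebra.smul_def]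
    exact Submodule.smul_mem _ _ ha
  | grade1 i =>
    rcases i with z | y
    · exact T.mul_idem_mem_turnSpan K ha z
    · exact T.turnSpan_anti K (Nat.le_succ N) (T.mul_arr_mem_turnSpan K ha y)
  | mul b c hb hc =>
    rw [map_mul, map_mul, ← mul_assoc]
    exact hc (hb ha)
  | add b c hb hc =>
    rw [map_add, map_add, mul_add]
    exact add_mem (hb ha) (hc ha)

theorem mem_turnSpan_zero (a : T.Omega K) : a ∈ T.turnSpan K 0 := by
  rw [← one_mul a]
  refine T.mul_mem_turnSpan K ?_ a
  rw [← sum_idem]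
  exact sum_mem fun z _ => T.turn_mem_turnSpan K (x := (z, false)) (Nat.zero_le 0)

theorem mul_mem_turnSpan_add_one {N : ℕ} {a b : T.Omega K} (ha : a ∈ T.turnSpan K N)
    (hb : b ∈ T.turnSpan K 1) : a * b ∈ T.turnSpan K (N + 1) := by
  induction hb using Submodule.span_induction with
  | mem b h =>
    obtain ⟨x, k, hk, rfl⟩ := h
    obtain ⟨k, rfl⟩ := Nat.exists_eq_add_of_le' hk
    rw [turn_succ', ← mul_assoc]
    exact T.mul_mem_turnSpan K (T.mul_arr_mem_turnSpan K ha x) _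
  | zero => rw [mul_zero]; exact zero_mem _
  | add a b _ _ ha hb => rw [mul_add]; exact add_mem ha hb
  | smul c a _ ha => rw [mul_smul_comm]; exact Submodule.smul_mem _ _ ha

theorem turnSpan_eq_bot {N : ℕ} (h : Fintype.card (E × Bool) < N) : T.turnSpan K N = ⊥ := by
  rw [eq_bot_iff, turnSpan, Submodule.span_le]
  rintro _ ⟨x, k, hk, rfl⟩
  exact T.turn_eq_zero K ((T.valency_le_card x).trans_lt (h.trans_le hk))

theorem finite_omega : Module.Finite K (T.Omega K) := by
  have hfin : (Set.range fun p : (E × Bool) × Fin (Fintype.card (E × Bool) + 1) =>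
    T.turn K p.1 p.2).Finite := Set.finite_range _
  suffices h : Submodule.span K (Set.range fun p : (E × Bool) × Fin (Fintype.card (E × Bool) + 1) =>
      T.turn K p.1 p.2) = ⊤ from ⟨h ▸ Submodule.fg_span hfin⟩
  refine eq_top_iff.2 fun a _ => ?_
  refine Submodule.span_le.2 ?_ (T.mem_turnSpan_zero K a)
  rintro _ ⟨x, k, -, rfl⟩
  by_cases hk : k < Fintype.card (E × Bool) + 1
  · exact Submodule.subset_span ⟨(x, ⟨k, hk⟩), rfl⟩
  · rw [T.turn_eq_zero K ((T.valency_le_card x).trans_lt (by omega))]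
    exact zero_mem _

/-! ### The spaces `e_y Ω(T) e_z` -/

/-- `e_y Ω(T) e_z` lies in any subspace that contains the turns from `y` to `z`. -/
theorem idem_mul_mul_idem_mem (W : Submodule K (T.Omega K)) {y z : E}
    (h : ∀ x k, x.1 = y → ((T.next ^ k) x).1 = z → T.turn K x k ∈ W) (a : T.Omega K) :
    T.idem K y * a * T.idem K z ∈ W := by
  have ha := T.mem_turnSpan_zero K a
  induction ha using Submodule.span_induction with
  | mem a h' =>
    obtain ⟨x, k, -, rfl⟩ := h'
    by_cases h1 : y = x.1
    · by_cases h2 : ((T.next ^ k) x).1 = z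
      · rw [h1, idem_mul_turn, ← h2, turn_mul_idem]
        exact h x k h1.symm h2
      · rw [mul_assoc, T.turn_mul_idem_of_ne K h2, mul_zero]
        exact zero_mem _
    · rw [T.idem_mul_turn_of_ne K h1, zero_mul]
      exact zero_mem _
  | zero => rw [mul_zero, zero_mul]; exact zero_mem _
  | add a b _ _ ha hb => rw [mul_add, add_mul]; exact add_mem ha hb
  | smul c a _ ha =>
    rw [mul_smul_comm, smul_mul_assoc]
    exact Submodule.smul_mem _ _ ha

theorem idem_mul_mul_idem_eq_zero {y z : E} (h : ∀ b c, T.vert (y, b) ≠ T.vert (z, c))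
    (a : T.Omega K) : T.idem K y * a * T.idem K z = 0 := by
  rw [← Submodule.mem_bot K]
  refine T.idem_mul_mul_idem_mem K ⊥ (fun x k hx hk => ?_) a
  subst hx hk
  exact absurd (T.vert_next_pow x k).symm (h x.2 _)

/-- If `x` and `y` are ends of different edges at the same vertex, and this is the only vertex
shared by these edges, then there is just one path between the edges, up to scalars. -/
theorem exists_idem_mul_mul_idem_eq_smul {x y : E × Bool} (hv : T.vert x = T.vert y)
    (h1 : T.vert (opp x) ≠ T.vert y) (h2 : T.vert x ≠ T.vert (opp y))
    (h3 : T.vert (opp x) ≠ T.vert (opp y)) (a : T.Omega K) :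
    ∃ c : K, T.idem K x.1 * a * T.idem K y.1 = c • T.turn K x (T.steps x y) := by
  suffices T.idem K x.1 * a * T.idem K y.1 ∈
      Submodule.span K {T.turn K x (T.steps x y)} by
    obtain ⟨c, hc⟩ := Submodule.mem_span_singleton.1 this
    exact ⟨c, hc.symm⟩
  refine T.idem_mul_mul_idem_mem K _ (fun w k hw hk => ?_) a
  have hvk := T.vert_next_pow w k
  obtain rfl | rfl := eq_or_eq_opp hw
  · obtain h | h := eq_or_eq_opp hk
    · rcases Nat.eq_zero_or_pos k with rfl | hpos
      · exact absurd (hv.trans (congrArg T.vert h.symm)) fun _ => by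
          rw [pow_zero, Equiv.Perm.one_apply] at h
          exact h3 (by rw [h])
      · rcases T.eq_steps_or_lt hpos h with rfl | hlt
        · exact Submodule.mem_span_singleton_self _
        · rw [T.turn_eq_zero K hlt]
          exact zero_mem _
    · rw [h] at hvk
      exact absurd hvk.symm h2
  · obtain h | h := eq_or_eq_opp hk <;> rw [h] at hvk
    · exact absurd hvk.symm h1
    · exact absurd hvk.symm h3

end BrauerLoopGraph

/-! ### Full turns do not vanish -/

namespace BrauerLoopGraph

section Socle

variable (K : Type*) [Field K] {V E : Type*} (T : BrauerLoopGraph V E) (i : E)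

open Classical in
/-- The action of the vertices and arrows of `Q_T` on functions on the paths that start at the edge
`i`: here `none` is the trivial path, `some (b, k)` is the turn of length `k + 1` that starts at the
end `(i, b)`, and an element `a` acts on functions through multiplication of paths by `a` from the
right. -/
noncomputable def turnAction :
    E ⊕ (E × Bool) → (Option (Bool × ℕ) → K) →ₗ[K] (Option (Bool × ℕ) → K)
  | .inl z =>
    { toFun f
        | none => if i = z then f none else 0
        | some (b, k) => if ((T.next ^ (k + 1)) (i, b)).1 = z then f (some (b, k)) else 0
      map_add' f g := by
        funext s
        rcases s with _ | ⟨b, k⟩ <;> simp only [Pi.add_apply] <;> split_ifs <;> simp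
      map_smul' c f := by
        funext s
        rcases s with _ | ⟨b, k⟩ <;> simp }
  | .inr y =>
    { toFun f
        | none => if i = y.1 then f (some (y.2, 0)) else 0
        | some (b, k) => if (T.next ^ (k + 1)) (i, b) = y then f (some (b, k + 1)) else 0
      map_add' f g := by
        funext s
        rcases s with _ | ⟨b, k⟩ <;> simp only [Pi.add_apply] <;> split_ifs <;> simp
      map_smul' c f := by
        funext s
        rcases s with _ | ⟨b, k⟩ <;> simp }

open Classical in
theorem turnAction_inl_none (z : E) (f : Option (Bool × ℕ) → K) :
    T.turnAction K i (.inl z) f none = if i = z then f none else 0 := rfl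

open Classical in
theorem turnAction_inl_some (z : E) (f : Option (Bool × ℕ) → K) (b : Bool) (k : ℕ) :
    T.turnAction K i (.inl z) f (some (b, k)) =
      if ((T.next ^ (k + 1)) (i, b)).1 = z then f (some (b, k)) else 0 := rfl

open Classical in
theorem turnAction_inr_none (y : E × Bool) (f : Option (Bool × ℕ) → K) :
    T.turnAction K i (.inr y) f none = if i = y.1 then f (some (y.2, 0)) else 0 := rfl

open Classical in
theorem turnAction_inr_some (y : E × Bool) (f : Option (Bool × ℕ) → K) (b : Bool) (k : ℕ) :
    T.turnAction K i (.inr y) f (some (b, k)) =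
      if (T.next ^ (k + 1)) (i, b) = y then f (some (b, k + 1)) else 0 := rfl

/-- The functions on the paths starting at `i` that vanish on the paths longer than a full turn and
take the same value at the two full turns: the dual of the projective module at `i`. -/
def socleModule : Submodule K (Option (Bool × ℕ) → K) where
  carrier := {f | (∀ b k, T.valency (i, b) ≤ k → f (some (b, k)) = 0) ∧
    f (some (false, T.valency (i, false) - 1)) = f (some (true, T.valency (i, true) - 1))}
  zero_mem' := ⟨fun _ _ _ => rfl, rfl⟩
  add_mem' := fun {f g} hf hg => ⟨fun b k hk => by simp [hf.1 b k hk, hg.1 b k hk], by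
    simp [hf.2, hg.2]⟩
  smul_mem' c f hf := ⟨fun b k hk => by simp [hf.1 b k hk], by simp [hf.2]⟩

variable [Fintype E]

theorem turnAction_mem (g : E ⊕ (E × Bool)) {f : Option (Bool × ℕ) → K}
    (hf : f ∈ T.socleModule K i) : T.turnAction K i g f ∈ T.socleModule K i := by
  have hpos := fun b => T.valency_pos (i, b)
  rcases g with z | y
  · refine ⟨fun b k hk => ?_, ?_⟩
    · simp [turnAction, hf.1 b k hk]
    · rw [turnAction_inl_some, turnAction_inl_some, Nat.sub_add_cancel (hpos _),
        Nat.sub_add_cancel (hpos _), next_pow_valency, next_pow_valency, hf.2]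
  · have h0 : ∀ b k, T.valency (i, b) ≤ k + 1 → T.turnAction K i (.inr y) f (some (b, k)) = 0 := by
      intro b k hk
      simp [turnAction, hf.1 b (k + 1) hk]
    refine ⟨fun b k hk => h0 b k (by omega), ?_⟩
    have h1 := hpos false
    have h2 := hpos true
    rw [h0 _ _ (by omega), h0 _ _ (by omega)]

/-- The module `socleModule` over the free algebra. -/
noncomputable def freeAction :
    FreeAlgebra K (E ⊕ (E × Bool)) →ₐ[K] Module.End K (T.socleModule K i) :=
  FreeAlgebra.lift K fun g => (T.turnAction K i g).restrict fun _ => T.turnAction_mem K i g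

open Classical in
/-- The module `socleModule` over the path algebra. -/
noncomputable def quiverAction : T.QuiverAlgebra K →ₐ[K] Module.End K (T.socleModule K i) :=
  RingQuot.liftAlgHom K ⟨T.freeAction K i, by
    intro a b h
    induction h with
    | idem z =>
      refine LinearMap.ext fun f => Subtype.ext (funext fun s => ?_)
      rcases s with _ | ⟨b, k⟩ <;> simp +contextual [freeAction, turnAction]
    | orth y z h =>
      refine LinearMap.ext fun f => Subtype.ext (funext fun s => ?_)
      rcases s with _ | ⟨b, k⟩ <;> simp [freeAction, turnAction]
      · rintro rfl h'
        exact absurd h' h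
      · rintro rfl h'
        exact absurd h' h
    | sum =>
      refine LinearMap.ext fun f => Subtype.ext (funext fun s => ?_)
      rcases s with _ | ⟨b, k⟩ <;> simp [freeAction, turnAction, LinearMap.sum_apply]
    | source y =>
      refine LinearMap.ext fun f => Subtype.ext (funext fun s => ?_)
      rcases s with _ | ⟨b, k⟩ <;> simp +contextual [freeAction, turnAction]
      rintro h h'
      exact absurd (congrArg Prod.fst h') h
    | target y =>
      refine LinearMap.ext fun f => Subtype.ext (funext fun s => ?_)
      rcases s with _ | ⟨b, k⟩ <;>
        simp only [freeAction, map_mul, FreeAlgebra.lift_ι_apply, Module.End.mul_apply,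
          LinearMap.coe_restrict_apply, turnAction_inr_none, turnAction_inr_some,
          turnAction_inl_some] <;> split_ifs with h h' <;> try rfl
      · refine absurd ?_ h'
        subst h
        rw [zero_add, pow_one]
      · refine absurd ?_ h'
        rw [← h, pow_succ' _ (k + 1), Equiv.Perm.mul_apply]⟩

theorem quiverAction_mk (g : E ⊕ (E × Bool)) (f : T.socleModule K i) :
    (T.quiverAction K i (PathAlgebra.mk K _ _ (FreeAlgebra.ι K g)) f).1 =
      T.turnAction K i g f.1 := by
  have : T.quiverAction K i (PathAlgebra.mk K _ _ (FreeAlgebra.ι K g)) =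
      T.freeAction K i (FreeAlgebra.ι K g) := RingQuot.liftAlgHom_mkAlgHom_apply _ _ _ _
  rw [this]
  simp [freeAction]

theorem quiverAction_triv (z : E) (f : T.socleModule K i) :
    (T.quiverAction K i (PathAlgebra.triv K _ _ z) f).1 = T.turnAction K i (.inl z) f.1 :=
  T.quiverAction_mk K i _ _

theorem quiverAction_qArrow (y : E × Bool) (f : T.socleModule K i) :
    (T.quiverAction K i (T.qArrow K y) f).1 = T.turnAction K i (.inr y) f.1 :=
  T.quiverAction_mk K i _ _

open Classical in
theorem quiverAction_qTurn_none (y : E × Bool) (k : ℕ) (f : T.socleModule K i) :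
    (T.quiverAction K i (T.qTurn K y (k + 1)) f).1 none =
      if i = y.1 then f.1 (some (y.2, k)) else 0 := by
  induction k generalizing f with
  | zero =>
    rw [qTurn, qTurn, map_mul, Module.End.mul_apply, quiverAction_triv, turnAction_inl_none,
      quiverAction_qArrow, pow_zero, Equiv.Perm.one_apply, turnAction_inr_none]
    split_ifs <;> rfl
  | succ k ih =>
    rw [qTurn, map_mul, Module.End.mul_apply, ih, quiverAction_qArrow, turnAction_inr_some]
    split_ifs with h h'
    · rfl
    · subst h
      exact absurd rfl h'
    · rfl

open Classical in
theorem quiverAction_qTurn_some (y : E × Bool) (b : Bool) (j k : ℕ) (f : T.socleModule K i) :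
    (T.quiverAction K i (T.qTurn K y (k + 1)) f).1 (some (b, j)) =
      if (T.next ^ (j + 1)) (i, b) = y then f.1 (some (b, j + k + 1)) else 0 := by
  induction k generalizing f with
  | zero =>
    rw [qTurn, qTurn, map_mul, Module.End.mul_apply, quiverAction_triv, turnAction_inl_some,
      quiverAction_qArrow, pow_zero, Equiv.Perm.one_apply, turnAction_inr_some]
    split_ifs with h h' h'
    · rfl
    · rfl
    · exact absurd (congrArg Prod.fst h') h
    · rfl
  | succ k ih =>
    rw [qTurn, map_mul, Module.End.mul_apply, ih, quiverAction_qArrow, turnAction_inr_some]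
    split_ifs with h h'
    · rfl
    · refine absurd ?_ h'
      rw [← h, ← Equiv.Perm.mul_apply, ← pow_add]
      congr 2
      omega
    · rfl

/-- The result of the action of a full turn is concentrated at the trivial path, because the
functions vanish on the paths longer than a full turn. -/
theorem quiverAction_qCycle_some (y : E × Bool) (b : Bool) (j : ℕ) (f : T.socleModule K i) :
    (T.quiverAction K i (T.qCycle K y) f).1 (some (b, j)) = 0 := by
  change (T.quiverAction K i (T.qTurn K y (T.valency y)) f).1 (some (b, j)) = 0
  obtain ⟨k, hk⟩ := Nat.exists_eq_add_of_le' (T.valency_pos y)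
  rw [hk, quiverAction_qTurn_some]
  split_ifs with h
  · apply f.2.1
    rw [← h, valency_next_pow] at hk
    omega
  · rfl

open Classical in
theorem quiverAction_qCycle_none (y : E × Bool) (f : T.socleModule K i) :
    (T.quiverAction K i (T.qCycle K y) f).1 none =
      if i = y.1 then f.1 (some (y.2, T.valency y - 1)) else 0 := by
  change (T.quiverAction K i (T.qTurn K y (T.valency y)) f).1 none = _
  obtain ⟨k, hk⟩ := Nat.exists_eq_add_of_le' (T.valency_pos y)
  rw [hk, quiverAction_qTurn_none, Nat.add_sub_cancel]

theorem quiverAction_arrow_mul_arrow {x y : E × Bool} (h : y ≠ T.next x) :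
    T.quiverAction K i (T.qArrow K x * T.qArrow K y) = 0 := by
  refine LinearMap.ext fun f => Subtype.ext (funext fun s => ?_)
  rw [map_mul, Module.End.mul_apply, quiverAction_qArrow]
  rcases s with _ | ⟨b, k⟩
  · rw [turnAction_inr_none, quiverAction_qArrow, turnAction_inr_some]
    split_ifs with h1 h2
    · subst h1
      exact absurd (by rw [← h2, zero_add, pow_one]) h
    · rfl
    · rfl
  · rw [turnAction_inr_some, quiverAction_qArrow, turnAction_inr_some]
    split_ifs with h1 h2
    · exact absurd (by rw [← h2, pow_succ' _ (k + 1), Equiv.Perm.mul_apply, h1]) h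
    · rfl
    · rfl

theorem quiverAction_qCycle_of_ne {y : E × Bool} (h : i ≠ y.1) :
    T.quiverAction K i (T.qCycle K y) = 0 := by
  refine LinearMap.ext fun f => Subtype.ext (funext fun s => ?_)
  rcases s with _ | ⟨b, k⟩
  · rw [quiverAction_qCycle_none, if_neg h]
    rfl
  · exact T.quiverAction_qCycle_some K i y b k f

theorem quiverAction_relator (hi : i ≠ T.loop) {a : T.QuiverAlgebra K} (h : T.IsRelator K a) :
    T.quiverAction K i a = 0 := by
  induction h with
  | change x hx => exact T.quiverAction_arrow_mul_arrow K i (by simpa using opp_ne x)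
  | exceptional => exact T.quiverAction_arrow_mul_arrow K i (by simp)
  | cycle x hx =>
    rw [map_sub, sub_eq_zero]
    by_cases hix : i = x.1
    · refine LinearMap.ext fun f => Subtype.ext (funext fun s => ?_)
      rcases s with _ | ⟨b, k⟩
      · rw [quiverAction_qCycle_none, quiverAction_qCycle_none, if_pos hix,
          if_pos (show i = (opp x).1 from hix)]
        obtain ⟨e, b⟩ := x
        obtain rfl : i = e := hix
        cases b
        · exact f.2.2
        · exact f.2.2.symm
      · rw [quiverAction_qCycle_some, quiverAction_qCycle_some]
    · rw [T.quiverAction_qCycle_of_ne K i hix, T.quiverAction_qCycle_of_ne K i (y := opp x) hix]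
  | square =>
    rw [map_sub, sub_eq_zero, T.quiverAction_qCycle_of_ne K i hi, sq]
    exact T.quiverAction_arrow_mul_arrow K i (by rw [T.next_loop]; simp)
  | anti =>
    rw [map_add, T.quiverAction_qCycle_of_ne K i hi, T.quiverAction_qCycle_of_ne K i hi, add_zero]

end Socle

variable (K : Type*) [Field K] {V E : Type*} [Fintype E] (T : BrauerLoopGraph V E)

/-- The full turns at an edge other than the loop do not vanish in `Ω(T)`. -/
theorem turn_valency_ne_zero {x : E × Bool} (hx : x.1 ≠ T.loop) :
    T.turn K x (T.valency x) ≠ 0 := by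
  classical
  let ρ : T.Omega K →ₐ[K] Module.End K (T.socleModule K x.1) :=
    RingQuot.liftAlgHom K ⟨T.quiverAction K x.1, fun a b h => by
      rw [h.2, map_zero, T.quiverAction_relator K x.1 hx h.1]⟩
  have hρ : ρ (T.turn K x (T.valency x)) = T.quiverAction K x.1 (T.qCycle K x) :=
    RingQuot.liftAlgHom_mkAlgHom_apply _ _ _ _
  -- the indicator function of the full turns
  let f : T.socleModule K x.1 :=
    ⟨fun s => s.elim 0 fun p => if p.2 + 1 = T.valency (x.1, p.1) then 1 else 0, by
      refine ⟨fun b k hk => if_neg (by simp only; omega), ?_⟩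
      have h1 := T.valency_pos (x.1, false)
      have h2 := T.valency_pos (x.1, true)
      simp [Nat.sub_add_cancel h1, Nat.sub_add_cancel h2]⟩
  intro h0
  have h1 := T.quiverAction_qCycle_none K x.1 x f
  rw [← hρ, h0, map_zero, if_pos rfl] at h1
  have h2 : f.1 (some (x.2, T.valency x - 1)) = 1 :=
    if_pos (Nat.sub_add_cancel (T.valency_pos x))
  rw [h2] at h1
  exact zero_ne_one h1

/-- The shortest path between two different ends at a vertex does not vanish in `Ω(T)`, and neither
does its product with the shortest path back. -/
theorem turn_steps_mul_ne_zero {x y : E × Bool} (hx : x.1 ≠ T.loop) (hv : T.vert x = T.vert y)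
    (hxy : x ≠ y) : T.turn K x (T.steps x y) * T.turn K y (T.steps y x) ≠ 0 := by
  have h := T.turn_add K x (T.steps x y) (T.steps y x)
  rw [T.next_pow_steps hv, T.steps_add_steps hv hxy] at h
  rw [← h]
  exact T.turn_valency_ne_zero K hx

end BrauerLoopGraph

/-! ### The tree `T` rooted at `S` -/

namespace BrauerLoopGraph

variable {V E : Type*} (T : BrauerLoopGraph V E)

theorem graph_isTree : T.graph.IsTree := T.isTree

/-- The distance of a vertex from `S`. -/
noncomputable def level (v : V) : ℕ := T.graph.dist T.center v

/-- The distance of an edge from `S`, i.e. of the end closer to `S`. -/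
noncomputable def depth (e : E) : ℕ :=
  min (T.level (T.vert (e, false))) (T.level (T.vert (e, true)))

theorem level_center : T.level T.center = 0 := SimpleGraph.dist_self

theorem eq_center_of_level {v : V} (h : T.level v = 0) : v = T.center :=
  (T.graph_isTree.connected.dist_eq_zero_iff.1 h).symm

theorem vert_of_loop {x : E × Bool} (h : x.1 = T.loop) : T.vert x = T.center := by
  obtain ⟨e, b⟩ := x
  obtain rfl : e = T.loop := h
  cases b
  · rfl
  · exact T.vert_loop.symm

theorem depth_eq (x : E × Bool) :
    T.depth x.1 = min (T.level (T.vert x)) (T.level (T.vert (opp x))) := by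
  obtain ⟨e, b⟩ := x
  cases b
  · rfl
  · exact min_comm _ _

theorem adj_opp {x : E × Bool} (h : x.1 ≠ T.loop) : T.graph.Adj (T.vert x) (T.vert (opp x)) := by
  obtain ⟨e, b⟩ := x
  have hne : T.vert (e, false) ≠ T.vert (e, true) := fun h' => h (T.eq_loop e h')
  cases b
  · exact ⟨hne, .inl ⟨e, rfl, rfl⟩⟩
  · exact ⟨hne.symm, .inr ⟨e, rfl, rfl⟩⟩

theorem level_cases {x : E × Bool} (h : x.1 ≠ T.loop) :
    T.level (T.vert x) = T.depth x.1 ∧ T.level (T.vert (opp x)) = T.depth x.1 + 1 ∨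
      T.level (T.vert x) = T.depth x.1 + 1 ∧ T.level (T.vert (opp x)) = T.depth x.1 := by
  rw [depth_eq]
  have := T.graph_isTree.dist_eq_dist_add_one_of_adj T.center (T.adj_opp h)
  unfold level
  omega

theorem depth_of_loop {e : E} (h : e = T.loop) : T.depth e = 0 := by
  rw [T.depth_eq (e, false), T.vert_of_loop h, level_center, Nat.zero_min]

theorem depth_le_level (x : E × Bool) : T.depth x.1 ≤ T.level (T.vert x) := by
  rw [depth_eq]
  exact min_le_left _ _

theorem level_le_depth_add_one (x : E × Bool) : T.level (T.vert x) ≤ T.depth x.1 + 1 := by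
  by_cases h : x.1 = T.loop
  · rw [T.vert_of_loop h, level_center]
    exact Nat.zero_le _
  · have := T.level_cases h
    omega

theorem depth_le_depth_add_one {x y : E × Bool} (h : T.vert x = T.vert y) :
    T.depth x.1 ≤ T.depth y.1 + 1 :=
  (T.depth_le_level x).trans (h ▸ T.level_le_depth_add_one y)

/-- Every vertex has at most one neighbour that is closer to `S`. -/
theorem eq_of_adj_of_level {u u' v : V} (h : T.graph.Adj u v) (h' : T.graph.Adj u' v)
    (hl : T.level v = T.level u + 1) (hl' : T.level v = T.level u' + 1) : u = u' := by
  obtain ⟨p, -, hp⟩ := T.graph_isTree.connected.exists_path_of_dist T.center u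
  obtain ⟨p', -, hp'⟩ := T.graph_isTree.connected.exists_path_of_dist T.center u'
  have h1 : (p.concat h).IsPath := SimpleGraph.Walk.isPath_of_length_eq_dist _ (by
    rw [SimpleGraph.Walk.length_concat, hp]; exact hl.symm)
  have h1' : (p'.concat h').IsPath := SimpleGraph.Walk.isPath_of_length_eq_dist _ (by
    rw [SimpleGraph.Walk.length_concat, hp']; exact hl'.symm)
  have := (T.graph_isTree.existsUnique_path T.center v).unique h1 h1'
  simpa using congrArg SimpleGraph.Walk.penultimate this

/-- The levels of the ends of two adjacent edges of different depth. -/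
theorem levels_of_depth {x y : E × Bool} (hv : T.vert x = T.vert y)
    (hd : T.depth y.1 = T.depth x.1 + 1) :
    T.level (T.vert (opp x)) = T.depth x.1 ∧ T.level (T.vert y) = T.depth x.1 + 1 ∧
      T.level (T.vert (opp y)) = T.depth x.1 + 2 := by
  have h1 := T.depth_le_level y
  have h2 := T.level_le_depth_add_one x
  rw [hv] at h2
  have hy : y.1 ≠ T.loop := fun h => by rw [T.depth_of_loop h] at hd; omega
  have hx : x.1 ≠ T.loop := fun h => by
    rw [← hv, T.vert_of_loop h, level_center] at h1
    omega
  have h3 := T.level_cases hy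
  have h4 := T.level_cases hx
  rw [hv] at h4
  omega

theorem eq_of_level {x y : E × Bool} (h : x.1 = y.1)
    (hl : T.level (T.vert x) < T.level (T.vert (opp x)))
    (hl' : T.level (T.vert y) < T.level (T.vert (opp y))) : x = y := by
  obtain rfl | rfl := eq_or_eq_opp h
  · rfl
  · rw [opp_opp] at hl
    omega

theorem edge_eq_of_vert_eq {x y : E × Bool} (h : T.vert x = T.vert y)
    (h' : T.vert (opp x) = T.vert (opp y)) : x.1 = y.1 := by
  refine T.eq_of_ends _ _ ?_
  have key : ∀ x : E × Bool,
      s(T.vert (x.1, false), T.vert (x.1, true)) = s(T.vert x, T.vert (opp x)) := by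
    rintro ⟨e, b⟩
    cases b
    · rfl
    · exact Sym2.eq_swap
  rw [key, key, h, h']

theorem ne_loop_of_depth {x y : E × Bool} (hv : T.vert x = T.vert y)
    (hd : T.depth y.1 = T.depth x.1 + 1) : x.1 ≠ T.loop := by
  intro hx
  have := (T.levels_of_depth hv hd).2.1
  rw [← hv, T.vert_of_loop hx, level_center] at this
  omega

/-- The parent of an edge is unique: there is at most one adjacent edge closer to `S`. -/
theorem parent_unique {x x' y y' : E × Bool} (hy : y.1 = y'.1) (hv : T.vert x = T.vert y)
    (hv' : T.vert x' = T.vert y') (hd : T.depth y.1 = T.depth x.1 + 1)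
    (hd' : T.depth y.1 = T.depth x'.1 + 1) : x.1 = x'.1 := by
  have h1 := T.levels_of_depth hv hd
  have h2 := T.levels_of_depth hv' (hy ▸ hd')
  obtain rfl := T.eq_of_level hy (by omega) (by omega)
  refine T.edge_eq_of_vert_eq (hv.trans hv'.symm) (T.eq_of_adj_of_level (v := T.vert y) ?_ ?_ ?_ ?_)
  · exact hv ▸ (T.adj_opp (T.ne_loop_of_depth hv hd)).symm
  · exact hv' ▸ (T.adj_opp (T.ne_loop_of_depth hv' hd')).symm
  · omega
  · omega

/-! ### The paths from `S` to the edges of `T` -/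

theorem pathTo_isPath (v : V) : (T.pathTo v).IsPath :=
  (T.isTree.existsUnique_path T.center v).choose_spec.1

theorem length_pathTo (v : V) : (T.pathTo v).length = T.level v := by
  obtain ⟨p, hp, hl⟩ := T.graph_isTree.connected.exists_path_of_dist T.center v
  rw [(T.graph_isTree.existsUnique_path T.center v).unique (T.pathTo_isPath v) hp, hl, level]

theorem level_getVert_pathTo (v : V) {j : ℕ} (hj : j ≤ T.level v) :
    T.level ((T.pathTo v).getVert j) = j := by
  have h1 := SimpleGraph.dist_le ((T.pathTo v).take j)
  have h2 := SimpleGraph.dist_le ((T.pathTo v).drop j)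
  have h3 := T.graph_isTree.connected.dist_triangle (u := T.center)
    (v := (T.pathTo v).getVert j) (w := v)
  rw [SimpleGraph.Walk.take_length, length_pathTo] at h1
  rw [SimpleGraph.Walk.drop_length, length_pathTo] at h2
  unfold level at *
  omega

theorem isExceptional_iff {z : E} : T.IsExceptional z ↔ T.depth z = 0 := by
  constructor
  · rintro ⟨b, hb⟩
    have := T.depth_le_level (z, b)
    rw [hb, level_center] at this
    exact Nat.le_zero.1 this
  · intro h
    rw [depth] at h
    rcases Nat.min_eq_zero_iff.1 h with h | h
    · exact ⟨false, T.eq_center_of_level h⟩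
    · exact ⟨true, T.eq_center_of_level h⟩

theorem ne_loop_of_depth_pos {z : E} (hz : 0 < T.depth z) : z ≠ T.loop := fun h => by
  rw [T.depth_of_loop h] at hz
  exact lt_irrefl _ hz

theorem exists_end_farVertex {z : E} (hz : 0 < T.depth z) :
    ∃ x : E × Bool, x.1 = z ∧ T.vert (opp x) = T.farVertex z ∧
      T.level (T.vert (opp x)) = T.level (T.vert x) + 1 := by
  have h := T.level_cases (x := (z, false)) (T.ne_loop_of_depth_pos hz)
  by_cases hlt : T.level (T.vert (z, false)) < T.level (T.vert (z, true))
  · refine ⟨(z, false), rfl, (if_pos hlt).symm, ?_⟩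
    simp only [opp, Bool.not_false] at h ⊢
    omega
  · refine ⟨(z, true), rfl, (if_neg hlt).symm, ?_⟩
    simp only [opp, Bool.not_false, Bool.not_true] at h ⊢
    omega

theorem level_farVertex {z : E} (hz : 0 < T.depth z) : T.level (T.farVertex z) = T.depth z + 1 := by
  obtain ⟨x, rfl, h1, h2⟩ := T.exists_end_farVertex hz
  rw [← h1, depth_eq]
  omega

theorem route_of_depth_zero {z : E} (hz : T.depth z = 0) : T.route z = [(z, false)] :=
  if_pos (T.isExceptional_iff.2 hz)

theorem route_of_depth_pos {z : E} (hz : 0 < T.depth z) :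
    T.route z = (T.pathTo (T.farVertex z)).darts.map fun d => T.endOfAdj d.adj :=
  if_neg fun h => hz.ne' (T.isExceptional_iff.1 h)

theorem length_route (z : E) : (T.route z).length = T.depth z + 1 := by
  rcases Nat.eq_zero_or_pos (T.depth z) with hz | hz
  · rw [T.route_of_depth_zero hz, hz]
    rfl
  · rw [T.route_of_depth_pos hz, List.length_map, SimpleGraph.Walk.length_darts, length_pathTo,
      T.level_farVertex hz]

theorem vert_route {z : E} (hz : 0 < T.depth z) {j : ℕ} (hj : j < (T.route z).length) :
    T.vert (T.route z)[j] = (T.pathTo (T.farVertex z)).getVert j ∧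
      T.vert (opp (T.route z)[j]) = (T.pathTo (T.farVertex z)).getVert (j + 1) := by
  have hj' : j < (T.pathTo (T.farVertex z)).darts.length := by
    rwa [T.route_of_depth_pos hz, List.length_map] at hj
  have : (T.route z)[j] = T.endOfAdj ((T.pathTo (T.farVertex z)).darts[j]).adj := by
    simp [T.route_of_depth_pos hz]
  rw [this]
  refine ⟨(T.endOfAdj_spec _).1.trans ?_, (T.endOfAdj_spec _).2.trans ?_⟩
  · simp [SimpleGraph.Walk.darts_getElem_eq_getVert]
  · simp [SimpleGraph.Walk.darts_getElem_eq_getVert]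

theorem level_route {z : E} (hz : 0 < T.depth z) {j : ℕ} (hj : j < (T.route z).length) :
    T.level (T.vert (T.route z)[j]) = j ∧ T.level (T.vert (opp (T.route z)[j])) = j + 1 := by
  have h := T.vert_route hz hj
  rw [length_route] at hj
  rw [h.1, h.2, T.level_getVert_pathTo _ (by rw [T.level_farVertex hz]; omega),
    T.level_getVert_pathTo _ (by rw [T.level_farVertex hz]; omega)]
  exact ⟨rfl, rfl⟩

theorem depth_route {z : E} {j : ℕ} (hj : j < (T.route z).length) :
    T.depth (T.route z)[j].1 = j := by
  rcases Nat.eq_zero_or_pos (T.depth z) with hz | hz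
  · have h0 : j = 0 := by
      rw [length_route, hz] at hj
      omega
    subst h0
    simp [T.route_of_depth_zero hz, hz]
  · have := T.level_route hz hj
    rw [depth_eq, this.1, this.2]
    omega

theorem route_getElem_depth (z : E) :
    ((T.route z)[T.depth z]'(by rw [length_route]; omega)).1 = z := by
  rcases Nat.eq_zero_or_pos (T.depth z) with hz | hz
  · simp [T.route_of_depth_zero hz, hz]
  · have hj : T.depth z < (T.route z).length := by rw [length_route]; omega
    have h1 := T.vert_route hz hj
    have h2 := T.level_route hz hj
    obtain ⟨x, hx, h3, h4⟩ := T.exists_end_farVertex hz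
    have h5 : (T.pathTo (T.farVertex z)).getVert (T.depth z + 1) = T.farVertex z := by
      rw [← T.level_farVertex hz, ← length_pathTo, SimpleGraph.Walk.getVert_length]
    have hne : (T.route z)[T.depth z].1 ≠ T.loop := by
      refine T.ne_loop_of_depth_pos ?_
      rwa [T.depth_route hj]
    refine Eq.trans ?_ hx
    rw [h5, ← h3] at h1
    refine T.edge_eq_of_vert_eq (T.eq_of_adj_of_level (T.adj_opp hne) ?_ ?_ ?_) h1.2
    · rw [h1.2]
      exact T.adj_opp (hx ▸ T.ne_loop_of_depth_pos hz)
    · omega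
    · rw [h1.2]
      exact h4

end BrauerLoopGraph

/-! ### Morphisms between the projective modules `P(z)` -/

namespace BrauerLoopGraph

variable (K : Type*) [Field K] {V E : Type*} [Fintype E] (T : BrauerLoopGraph V E)

theorem mul_idem_of_mem_proj {z : E} {p : T.Omega K} (hp : p ∈ T.proj K z) :
    p * T.idem K z = p := by
  obtain ⟨a, rfl⟩ := Submodule.mem_span_singleton.1 hp
  rw [smul_eq_mul, mul_assoc, idem_mul_self]

theorem idem_mem_proj (z : E) : T.idem K z ∈ T.proj K z := Submodule.mem_span_singleton_self _

theorem coe_rightMul (y z : E) (a : T.Omega K) (p : T.proj K y) :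
    (T.rightMul K y z a p : T.Omega K) = p * (a * T.idem K z) := rfl

theorem rightMul_congr {y z : E} {a b : T.Omega K}
    (h : T.idem K y * a * T.idem K z = T.idem K y * b * T.idem K z) :
    T.rightMul K y z a = T.rightMul K y z b := by
  refine LinearMap.ext fun p => Subtype.ext ?_
  rw [coe_rightMul, coe_rightMul, ← T.mul_idem_of_mem_proj K p.2, mul_assoc, mul_assoc,
    ← mul_assoc (T.idem K y), h, mul_assoc]

theorem rightMul_eq_zero_iff {y z : E} {a : T.Omega K} :
    T.rightMul K y z a = 0 ↔ T.idem K y * a * T.idem K z = 0 := by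
  constructor
  · intro h
    have := congrArg Subtype.val (LinearMap.congr_fun h ⟨_, T.idem_mem_proj K y⟩)
    rw [coe_rightMul] at this
    rw [mul_assoc]
    exact this
  · intro h
    refine LinearMap.ext fun p => Subtype.ext ?_
    rw [coe_rightMul, ← T.mul_idem_of_mem_proj K p.2, mul_assoc, ← mul_assoc (T.idem K y), h,
      mul_zero]
    rfl

theorem exists_eq_rightMul {y z : E} (f : T.proj K y →ₗ[T.Omega K] T.proj K z) :
    ∃ a, f = T.rightMul K y z a := by
  refine ⟨(f ⟨_, T.idem_mem_proj K y⟩ : T.Omega K), LinearMap.ext fun p => Subtype.ext ?_⟩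
  rw [coe_rightMul, T.mul_idem_of_mem_proj K (Subtype.prop _), ← smul_eq_mul, ← Submodule.coe_smul,
    ← map_smul]
  congr 2
  exact Subtype.ext (T.mul_idem_of_mem_proj K p.2).symm

theorem rightMul_comp (x y z : E) (a b : T.Omega K) :
    (T.rightMul K y z b).comp (T.rightMul K x y a) = T.rightMul K x z (a * T.idem K y * b) := by
  refine LinearMap.ext fun p => Subtype.ext ?_
  simp only [LinearMap.comp_apply, coe_rightMul, mul_assoc]

/-- Right multiplication by an element of `Ω(T)`, between the terms of two complexes. -/
noncomputable def mulMap : ∀ o o' : Option (E × Bool), T.Omega K → (T.term K o ⟶ T.term K o')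
  | some x, some y, a => ModuleCat.ofHom (T.rightMul K x.1 y.1 a)
  | some _, none, _ => 0
  | none, _, _ => 0

theorem term_none_hom_ext {X : ModuleCat (T.Omega K)} (f g : T.term K none ⟶ X) : f = g := by
  ext p
  obtain rfl : p = 0 := Subsingleton.elim (α := PUnit) _ _
  rw [map_zero, map_zero]

theorem hom_term_none_ext {X : ModuleCat (T.Omega K)} (f g : X ⟶ T.term K none) : f = g := by
  ext p
  exact Subsingleton.elim (α := PUnit) _ _

theorem mulMap_add (o o' : Option (E × Bool)) (a b : T.Omega K) :
    T.mulMap K o o' (a + b) = T.mulMap K o o' a + T.mulMap K o o' b := by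
  rcases o with _ | x
  · exact T.term_none_hom_ext K _ _
  · rcases o' with _ | y
    · exact T.hom_term_none_ext K _ _
    · ext p
      apply Subtype.ext
      change p.1 * ((a + b) * T.idem K y.1) = p.1 * (a * T.idem K y.1) + p.1 * (b * T.idem K y.1)
      rw [add_mul, mul_add]

theorem mulMap_zero (o o' : Option (E × Bool)) : T.mulMap K o o' 0 = 0 := by
  have := T.mulMap_add K o o' 0 0
  rwa [add_zero, left_eq_add] at this

theorem hom_eq_zero_of_forall_ne {x y : E × Bool} (h : ∀ b c, T.vert (x.1, b) ≠ T.vert (y.1, c))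
    (f : T.term K (some x) ⟶ T.term K (some y)) : f = 0 := by
  obtain ⟨a, ha⟩ := T.exists_eq_rightMul K f.hom
  apply ModuleCat.hom_ext
  rw [ha]
  exact (T.rightMul_eq_zero_iff K).2 (T.idem_mul_mul_idem_eq_zero K h a)

theorem hom_eq_zero_of_depth {x y : E × Bool}
    (h : T.depth x.1 + 1 < T.depth y.1 ∨ T.depth y.1 + 1 < T.depth x.1)
    (f : T.term K (some x) ⟶ T.term K (some y)) : f = 0 := by
  refine T.hom_eq_zero_of_forall_ne K (fun b c hbc => ?_) f
  have h1 := T.depth_le_depth_add_one hbc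
  have h2 := T.depth_le_depth_add_one hbc.symm
  simp only at h1 h2
  omega

/-- The morphisms between `P(x)` and `P(y)`, for adjacent edges of different depth. -/
theorem exists_smul_of_depth {x y : E × Bool} (hv : T.vert x = T.vert y)
    (hd : T.depth y.1 = T.depth x.1 + 1 ∨ T.depth x.1 = T.depth y.1 + 1) (a : T.Omega K) :
    ∃ c : K, T.idem K x.1 * a * T.idem K y.1 = c • T.turn K x (T.steps x y) := by
  refine T.exists_idem_mul_mul_idem_eq_smul K hv ?_ ?_ ?_ a <;> intro h <;>
    have h' := congrArg T.level h <;> have h'' := congrArg T.level hv <;> rcases hd with hd | hd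
  all_goals
    first
    | have := T.levels_of_depth hv hd
      omega
    | have := T.levels_of_depth hv.symm hd
      omega

theorem idem_mul_link {x y : E × Bool} : T.idem K x.1 * T.link K x y = T.link K x y :=
  T.idem_mul_turn K (opp x) _

theorem link_mul_idem {x y : E × Bool} (h : T.Follows x y) :
    T.link K x y * T.idem K y.1 = T.link K x y := by
  have := T.turn_mul_idem K (opp x) (T.steps (opp x) y)
  rwa [T.next_pow_steps h.1] at this

/-- A morphism `P(x₁) → P(y)` to a module that belongs to an edge closer to `S` vanishes if its
composition with the differential `P(x₀) → P(x₁)` vanishes: it is a multiple of the shortest path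
from `x₁` to `y`, and the composition is the same multiple of a full turn. -/
theorem hom_eq_zero_of_termMap_comp {x₀ x₁ y : E × Bool} (hf : T.Follows x₀ x₁)
    (hd : T.depth x₁.1 = T.depth x₀.1 + 1) (hy : T.depth x₁.1 = T.depth y.1 + 1)
    (f : T.term K (some x₁) ⟶ T.term K (some y))
    (h : T.termMap K (some x₀) (some x₁) ≫ f = 0) : f = 0 := by
  by_cases hs : ∀ b c, T.vert (x₁.1, b) ≠ T.vert (y.1, c)
  · exact T.hom_eq_zero_of_forall_ne K hs f
  push Not at hs
  obtain ⟨b, c, hbc⟩ := hs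
  have hp : x₀.1 = y.1 :=
    T.parent_unique (x := opp x₀) (y := x₁) (x' := (y.1, c)) (y' := (x₁.1, b)) rfl hf.1
      hbc.symm hd hy
  obtain ⟨a, ha⟩ := T.exists_eq_rightMul K f.hom
  have hne : opp x₀ ≠ x₁ := fun h => by
    rw [← h] at hd
    exact absurd hd (by simp [opp])
  obtain ⟨s, hs⟩ := T.exists_smul_of_depth K hf.1.symm (.inr hd) a
  have h1 : (T.rightMul K x₁.1 y.1 a).comp (T.rightMul K x₀.1 x₁.1 (T.link K x₀ x₁)) = 0 := by
    rw [← ha]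
    exact congrArg ModuleCat.Hom.hom h
  rw [rightMul_comp, rightMul_eq_zero_iff, ← mul_assoc, ← mul_assoc, idem_mul_link,
    mul_assoc, mul_assoc, ← mul_assoc (T.idem K _), ← hp] at h1
  rw [show T.idem K x₁.1 * a * T.idem K x₀.1 = _ from hs, mul_smul_comm, smul_eq_zero] at h1
  have h2 := T.turn_steps_mul_ne_zero K (x := opp x₀) (T.ne_loop_of_depth hf.1 hd) hf.1 hne
  have h3 := h1.resolve_right h2
  rw [h3, zero_smul] at hs
  apply ModuleCat.hom_ext
  rw [ha]
  refine (T.rightMul_eq_zero_iff K).2 ?_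
  rw [← hp]
  exact hs

/-- A morphism `P(x) → P(y₁)` to a module that belongs to an edge further away from `S` is a
multiple of the differential `P(y₀) → P(y₁)` if `x = y₀`, and zero otherwise. -/
theorem exists_eq_mulMap_comp_termMap {x y₀ y₁ : E × Bool} (hf : T.Follows y₀ y₁)
    (hd : T.depth y₁.1 = T.depth y₀.1 + 1) (hx : T.depth y₁.1 = T.depth x.1 + 1)
    (f : T.term K (some x) ⟶ T.term K (some y₁)) :
    ∃ c : K, f = T.mulMap K (some x) (some y₀) (c • 1) ≫ T.termMap K (some y₀) (some y₁) ∧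
      (c ≠ 0 → x.1 = y₀.1) := by
  by_cases hs : ∀ b c, T.vert (x.1, b) ≠ T.vert (y₁.1, c)
  · refine ⟨0, ?_, fun h => absurd rfl h⟩
    rw [zero_smul, mulMap_zero, zero_comp]
    exact T.hom_eq_zero_of_forall_ne K hs f
  push Not at hs
  obtain ⟨b, c, hbc⟩ := hs
  have hp : x.1 = y₀.1 :=
    T.parent_unique (x := (x.1, b)) (y := (y₁.1, c)) (x' := opp y₀) (y' := y₁) rfl hbc hf.1 hx hd
  obtain ⟨a, ha⟩ := T.exists_eq_rightMul K f.hom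
  obtain ⟨s, hs⟩ := T.exists_smul_of_depth K hf.1 (.inl hd) a
  refine ⟨s, ?_, fun _ => hp⟩
  apply ModuleCat.hom_ext
  rw [ha]
  refine Eq.trans ?_ (T.rightMul_comp K x.1 y₀.1 y₁.1 (s • 1) (T.link K y₀ y₁)).symm
  refine T.rightMul_congr K ?_
  rw [smul_mul_assoc, one_mul, smul_mul_assoc, idem_mul_link, hp, mul_smul_comm, idem_mul_link,
    smul_mul_assoc, link_mul_idem K T hf]
  exact hs

end BrauerLoopGraph

/-! ### Morphisms between the complexes `Q(z)` -/

namespace BrauerLoopGraph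

section Route

variable {V E : Type*} (T : BrauerLoopGraph V E)

theorem entry_eq_some {l : List (E × Bool)} {p : ℤ} {x : E × Bool} :
    entry l p = some x ↔ ∃ j : ℕ, p = j ∧ l[j]? = some x := by
  constructor
  · intro h
    unfold entry at h
    split_ifs at h with h0
    exact ⟨p.toNat, (Int.toNat_of_nonneg h0).symm, h⟩
  · rintro ⟨j, rfl, h⟩
    rw [entry, if_pos (Int.natCast_nonneg j), Int.toNat_natCast, h]

theorem entry_natCast (l : List (E × Bool)) (j : ℕ) : entry l j = l[j]? := by
  rw [entry, if_pos (Int.natCast_nonneg j), Int.toNat_natCast]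

theorem entry_of_neg (l : List (E × Bool)) {p : ℤ} (hp : p < 0) : entry l p = none :=
  if_neg (not_le.2 hp)

theorem depth_of_entry {z : E} {p : ℤ} {x : E × Bool} (h : entry (T.route z) p = some x) :
    (T.depth x.1 : ℤ) = p := by
  obtain ⟨j, rfl, h⟩ := entry_eq_some.1 h
  obtain ⟨hj, rfl⟩ := List.getElem?_eq_some_iff.1 h
  exact congrArg _ (T.depth_route hj)

theorem exists_entry_pred {z : E} {j : ℕ} {x : E × Bool}
    (h : entry (T.route z) ((j + 1 : ℕ) : ℤ) = some x) :
    ∃ x₀, entry (T.route z) (j : ℤ) = some x₀ ∧ T.Follows x₀ x := by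
  rw [entry_natCast] at h
  obtain ⟨hj, rfl⟩ := List.getElem?_eq_some_iff.1 h
  refine ⟨(T.route z)[j], ?_, List.isChain_iff_getElem.1 (T.isChain_route z) j hj⟩
  rw [entry_natCast, List.getElem?_eq_getElem]

/-- If two of the paths from `S` have a common edge, then they agree up to this edge. -/
theorem entry_eq_entry {z w : E} {k : ℕ} (hk : 1 ≤ k) {x y : E × Bool}
    (hx : entry (T.route z) (k : ℤ) = some x) (hy : entry (T.route w) (k : ℤ) = some y)
    (hxy : x.1 = y.1) {j : ℕ} (hj : j ≤ k) :
    entry (T.route z) (j : ℤ) = entry (T.route w) (j : ℤ) ∧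
      (entry (T.route z) (j : ℤ)).isSome := by
  rw [entry_natCast] at hx hy
  obtain ⟨hzk, rfl⟩ := List.getElem?_eq_some_iff.1 hx
  obtain ⟨hwk, rfl⟩ := List.getElem?_eq_some_iff.1 hy
  have hz : 0 < T.depth z := by rw [length_route] at hzk; omega
  have hw : 0 < T.depth w := by rw [length_route] at hwk; omega
  obtain ⟨i, rfl⟩ := Nat.exists_eq_add_of_le hj
  have key : (T.route z)[j].1 = (T.route w)[j].1 := by
    clear hx hy hk
    induction i generalizing j with
    | zero => exact hxy
    | succ i ih =>
      have h1 : j + 1 + i = j + (i + 1) := by omega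
      have h2 := ih (j := j + 1) (by omega) (by omega) (by omega) (by simpa only [h1] using hxy)
      have h3 := List.isChain_iff_getElem.1 (T.isChain_route z) j (by omega)
      have h4 := List.isChain_iff_getElem.1 (T.isChain_route w) j (by omega)
      refine T.parent_unique (x := opp (T.route z)[j]) (x' := opp (T.route w)[j]) h2 h3.1 h4.1 ?_ ?_
      · rw [T.depth_route]
        exact congrArg (· + 1) (T.depth_route (z := z) _).symm
      · rw [T.depth_route]
        exact congrArg (· + 1) (T.depth_route (z := w) _).symm
  have hzj := T.level_route hz (j := j) (by omega)
  have hwj := T.level_route hw (j := j) (by omega)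
  rw [entry_natCast, entry_natCast, List.getElem?_eq_getElem (by omega),
    List.getElem?_eq_getElem (by omega)]
  exact ⟨congrArg some (T.eq_of_level key (by omega) (by omega)), rfl⟩

end Route

variable (K : Type*) [Field K] {V E : Type*} [Fintype E] (T : BrauerLoopGraph V E)

theorem rickardComplex_d (z : E) (p : ℤ) :
    (T.rickardComplex K z).d p (p + 1) =
      T.termMap K (entry (T.route z) p) (entry (T.route z) (p + 1)) :=
  CochainComplex.of_d (fun n => T.term K (entry (T.route z) n))
    (fun n => T.termMap K (entry (T.route z) n) (entry (T.route z) (n + 1))) p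

/-- Multiplication by a scalar on the common terms of the complexes `Q(z)` and `Q(w)`. -/
noncomputable def scaleMap (z w : E) (p : ℤ) (c : K) :
    (T.rickardComplex K z).X p ⟶ (T.rickardComplex K w).X p :=
  T.mulMap K (entry (T.route z) p) (entry (T.route w) p) (c • 1)

theorem scaleMap_add (z w : E) (p : ℤ) (c c' : K) :
    T.scaleMap K z w p (c + c') = T.scaleMap K z w p c + T.scaleMap K z w p c' := by
  unfold scaleMap
  rw [add_smul, mulMap_add]
  rfl

theorem scaleMap_zero (z w : E) (p : ℤ) : T.scaleMap K z w p 0 = 0 := by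
  unfold scaleMap
  rw [zero_smul, mulMap_zero]
  rfl

theorem rickardComplex_hom_eq_zero_of_entry {z w : E} {p q : ℤ}
    (h : ∀ x y, entry (T.route z) p = some x → entry (T.route w) q = some y →
      ∀ f : T.term K (some x) ⟶ T.term K (some y), f = 0)
    (f : (T.rickardComplex K z).X p ⟶ (T.rickardComplex K w).X q) : f = 0 := by
  have key : ∀ o o' : Option (E × Bool), (∀ x y, o = some x → o' = some y →
      ∀ f : T.term K (some x) ⟶ T.term K (some y), f = 0) →
      ∀ f : T.term K o ⟶ T.term K o', f = 0 := by
    intro o o' h f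
    rcases o with _ | x
    · exact T.term_none_hom_ext K _ _
    · rcases o' with _ | y
      · exact T.hom_term_none_ext K _ _
      · exact h x y rfl rfl f
  exact key _ _ h f

/-- There are no morphisms between terms whose degrees differ by at least two. -/
theorem rickardComplex_hom_eq_zero {z w : E} {p q : ℤ} (h : p + 1 < q ∨ q + 1 < p)
    (f : (T.rickardComplex K z).X p ⟶ (T.rickardComplex K w).X q) : f = 0 := by
  refine T.rickardComplex_hom_eq_zero_of_entry K
    (fun x y hx hy f => T.hom_eq_zero_of_depth K ?_ f) f
  have h1 := T.depth_of_entry hx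
  have h2 := T.depth_of_entry hy
  omega

/-- A morphism from the term of degree `j + 1` to the term of degree `j` vanishes if its composition
with the differential vanishes. -/
theorem rickardComplex_hom_eq_zero_of_d_comp {z w : E} (j : ℕ)
    (f : (T.rickardComplex K z).X (j + 1) ⟶ (T.rickardComplex K w).X j)
    (h : (T.rickardComplex K z).d j (j + 1) ≫ f = 0) : f = 0 := by
  rw [rickardComplex_d] at h
  have key : ∀ o₀ o₁ o' : Option (E × Bool), (∀ x₁ y, o₁ = some x₁ → o' = some y →
      T.depth x₁.1 = j + 1 ∧ T.depth y.1 = j ∧ ∃ x₀, o₀ = some x₀ ∧ T.Follows x₀ x₁ ∧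
        T.depth x₀.1 = j) →
      ∀ f : T.term K o₁ ⟶ T.term K o', T.termMap K o₀ o₁ ≫ f = 0 → f = 0 := by
    intro o₀ o₁ o' h f hf
    rcases o₁ with _ | x
    · exact T.term_none_hom_ext K _ _
    · rcases o' with _ | y
      · exact T.hom_term_none_ext K _ _
      · obtain ⟨h1, h2, x₀, rfl, h3, h4⟩ := h x y rfl rfl
        exact T.hom_eq_zero_of_termMap_comp K h3 (by omega) (by omega) f hf
  refine key _ _ _ (fun x₁ y hx hy => ?_) f h
  have h1 := T.depth_of_entry hx
  have h2 := T.depth_of_entry hy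
  obtain ⟨x₀, h3, h4⟩ := T.exists_entry_pred (j := j) (by simpa using hx)
  have h5 := T.depth_of_entry h3
  exact ⟨by omega, by omega, x₀, h3, h4, by omega⟩

/-- The morphisms from the term of degree `j` to the term of degree `j + 1` are multiples of the
differential. -/
theorem exists_rickardComplex_hom_eq {z w : E} (j : ℕ)
    (f : (T.rickardComplex K z).X j ⟶ (T.rickardComplex K w).X (j + 1)) :
    ∃ c : K, f = T.scaleMap K z w j c ≫ (T.rickardComplex K w).d j (j + 1) ∧
      (c ≠ 0 → ∃ x y, entry (T.route z) j = some x ∧ entry (T.route w) j = some y ∧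
        x.1 = y.1) := by
  rw [rickardComplex_d]
  have key : ∀ o o₀' o₁' : Option (E × Bool), (∀ x y₁, o = some x → o₁' = some y₁ →
      T.depth x.1 = j ∧ T.depth y₁.1 = j + 1 ∧ ∃ y₀, o₀' = some y₀ ∧ T.Follows y₀ y₁ ∧
        T.depth y₀.1 = j) →
      ∀ f : T.term K o ⟶ T.term K o₁', ∃ c : K,
        f = T.mulMap K o o₀' (c • 1) ≫ T.termMap K o₀' o₁' ∧
        (c ≠ 0 → ∃ x y, o = some x ∧ o₀' = some y ∧ x.1 = y.1) := by
    intro o o₀' o₁' h f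
    rcases o with _ | x
    · exact ⟨0, T.term_none_hom_ext K _ _, fun h => absurd rfl h⟩
    · rcases o₁' with _ | y₁
      · exact ⟨0, T.hom_term_none_ext K _ _, fun h => absurd rfl h⟩
      · obtain ⟨h1, h2, y₀, rfl, h3, h4⟩ := h x y₁ rfl rfl
        obtain ⟨c, hc, hc'⟩ :=
          T.exists_eq_mulMap_comp_termMap K h3 (by omega) (by omega) f
        exact ⟨c, hc, fun h => ⟨x, y₀, rfl, rfl, hc' h⟩⟩
  refine key _ _ _ (fun x y₁ hx hy => ?_) f
  have h1 := T.depth_of_entry hx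
  have h2 := T.depth_of_entry hy
  obtain ⟨y₀, h3, h4⟩ := T.exists_entry_pred (j := j) (by simpa using hy)
  have h5 := T.depth_of_entry h3
  exact ⟨by omega, by omega, y₀, h3, h4, by omega⟩

theorem scaleMap_comp_d {z w : E} {j : ℕ} {x₁ : E × Bool} (c : K)
    (h₀ : entry (T.route z) j = entry (T.route w) j)
    (h₁ : entry (T.route z) (j + 1 : ℕ) = some x₁) (h₁' : entry (T.route w) (j + 1 : ℕ) = some x₁) :
    T.scaleMap K z w j c ≫ (T.rickardComplex K w).d j (j + 1) =
      (T.rickardComplex K z).d j (j + 1) ≫ T.scaleMap K z w (j + 1) c := by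
  obtain ⟨x₀, h₂, hf⟩ := T.exists_entry_pred h₁
  rw [rickardComplex_d, rickardComplex_d]
  unfold scaleMap
  have key : ∀ o o' o₁ o₁' : Option (E × Bool), o = some x₀ → o' = some x₀ → o₁ = some x₁ →
      o₁' = some x₁ → T.mulMap K o o' (c • 1) ≫ T.termMap K o' o₁' =
        T.termMap K o o₁ ≫ T.mulMap K o₁ o₁' (c • 1) := by
    rintro _ _ _ _ rfl rfl rfl rfl
    apply ModuleCat.hom_ext
    refine (T.rightMul_comp K x₀.1 x₀.1 x₁.1 (c • 1) (T.link K x₀ x₁)).trans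
      (Eq.trans ?_ (T.rightMul_comp K x₀.1 x₁.1 x₁.1 (T.link K x₀ x₁) (c • 1)).symm)
    refine T.rightMul_congr K ?_
    simp only [T.link_mul_idem K hf, smul_mul_assoc, mul_smul_comm, one_mul, mul_one,
      idem_mul_link]
  exact key _ _ _ _ h₂ (h₀ ▸ h₂) h₁ h₁'

open CochainComplex.HomComplex

/-- Every cochain of degree one between the complexes `Q(z)` and `Q(w)` is a coboundary. -/
theorem exists_δ_eq {z w : E} (g : Cochain (T.rickardComplex K z) (T.rickardComplex K w) 1) :
    ∃ h : Cochain (T.rickardComplex K z) (T.rickardComplex K w) 0, δ 0 1 h = g := by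
  choose c hc hc' using fun j : ℕ => T.exists_rickardComplex_hom_eq K j (g.v j (j + 1) rfl)
  -- `g` is `c j` times the differential in degree `j`, so that the coefficients `a j` of a
  -- contraction of `g` have to satisfy `a j - a (j + 1) = c j`
  let a : ℕ → K := fun j => ∑ k ∈ Finset.Ico j (T.route z).length, c k
  have ha : ∀ j, a j = c j + a (j + 1) := by
    intro j
    by_cases hj : j < (T.route z).length
    · exact Finset.sum_eq_sum_Ico_succ_bot hj c
    · have h0 : c j = 0 := by
        by_contra h
        obtain ⟨x, y, hx, -⟩ := hc' j h
        rw [entry_natCast] at hx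
        exact hj (List.getElem?_eq_some_iff.1 hx).1
      rw [h0, zero_add]
      simp only [a]
      rw [Finset.Ico_eq_empty (by omega), Finset.Ico_eq_empty (by omega)]
  have ha' : ∀ j, a (j + 1) ≠ 0 → ∃ k, j + 1 ≤ k ∧ c k ≠ 0 := by
    intro j h
    obtain ⟨k, hk, hk'⟩ := Finset.exists_ne_zero_of_sum_ne_zero h
    exact ⟨k, (Finset.mem_Ico.1 hk).1, hk'⟩
  refine ⟨Cochain.ofHoms fun p => T.scaleMap K z w p (a p.toNat), Cochain.ext _ _ fun p q hpq => ?_⟩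
  obtain rfl : q = p + 1 := hpq.symm
  rw [δ_zero_cochain_v, Cochain.ofHoms_v, Cochain.ofHoms_v]
  rcases lt_or_ge p 0 with hp | hp
  · have h0 : ∀ f : (T.rickardComplex K z).X p ⟶ (T.rickardComplex K w).X (p + 1), f = 0 :=
      T.rickardComplex_hom_eq_zero_of_entry K fun x y hx => by
        rw [entry_of_neg _ hp] at hx
        exact absurd hx (by simp)
    rw [h0 (g.v p (p + 1) hpq)]
    exact h0 _
  · obtain ⟨j, rfl⟩ := Int.eq_ofNat_of_zero_le hp
    have e : ((j : ℤ) + 1).toNat = j + 1 := by omega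
    rw [hc j, e, Int.toNat_natCast, ha j, scaleMap_add, Preadditive.add_comp, add_sub_assoc]
    refine (add_eq_left.2 (sub_eq_zero.2 ?_))
    by_cases h0 : a (j + 1) = 0
    · rw [h0, scaleMap_zero, scaleMap_zero, zero_comp, comp_zero]
    · obtain ⟨k, hk, hk'⟩ := ha' j h0
      obtain ⟨x, y, hx, hy, hxy⟩ := hc' k hk'
      obtain ⟨h1, h2⟩ := T.entry_eq_entry (by omega) hx hy hxy (j := j) (by omega)
      obtain ⟨h3, h4⟩ := T.entry_eq_entry (by omega) hx hy hxy hk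
      obtain ⟨x₁, hx₁⟩ := Option.isSome_iff_exists.1 h4
      exact T.scaleMap_comp_d K _ h1 hx₁ (h3 ▸ hx₁)

/-- Every cocycle of nonzero degree between the complexes `Q(z)` and `Q(w)` is a coboundary. -/
theorem cocycle_mem_coboundaries {z w : E} {n : ℤ} (hn : n ≠ 0)
    (g : Cocycle (T.rickardComplex K z) (T.rickardComplex K w) n) :
    g ∈ coboundaries (T.rickardComplex K z) (T.rickardComplex K w) n := by
  by_cases h1 : n = 1
  · subst h1
    exact (mem_coboundaries_iff g 0 rfl).2 (T.exists_δ_eq K g.1)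
  · suffices h : g = 0 by
      rw [h]
      exact zero_mem _
    refine Cocycle.ext (Cochain.ext _ _ fun p q hpq => ?_)
    rw [Cocycle.coe_zero, Cochain.zero_v]
    by_cases h2 : n = -1
    · -- the cocycle condition shows successively that the components of `g` vanish, starting with
      -- the component that has its target in degree `0`
      subst h2
      clear h1 hn
      have hδ : ∀ p q h, g.1.v p q h = 0 →
          (T.rickardComplex K z).d p (p + 1) ≫ g.1.v (p + 1) p (by omega) = 0 := by
        intro p q h hp
        have := Cochain.congr_v (g.δ_eq_zero 0) p p (add_zero p)
        rw [δ_v (-1) 0 rfl g.1 p p (add_zero p) q (p + 1) (by omega) rfl, hp, zero_comp, zero_add,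
          Int.negOnePow_zero, one_smul] at this
        exact this
      have hneg : ∀ p q h, q < 0 → g.1.v p q h = 0 := fun p q h hq =>
        T.rickardComplex_hom_eq_zero_of_entry K (fun x y _ hy => by
          rw [entry_of_neg _ hq] at hy
          exact absurd hy (by simp)) _
      rcases lt_or_ge q 0 with hq | hq
      · exact hneg p q hpq hq
      · obtain ⟨j, rfl⟩ := Int.eq_ofNat_of_zero_le hq
        clear hq
        induction j generalizing p with
        | zero =>
          obtain rfl : p = ((0 : ℕ) : ℤ) + 1 := by omega
          exact T.rickardComplex_hom_eq_zero_of_d_comp K 0 _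
            (hδ _ (-1) (by omega) (hneg _ _ _ (by omega)))
        | succ j ih =>
          obtain rfl : p = ((j + 1 : ℕ) : ℤ) + 1 := by omega
          exact T.rickardComplex_hom_eq_zero_of_d_comp K (j + 1) _
            (hδ _ (j : ℤ) (by omega) (ih _ _ hδ))
    · exact T.rickardComplex_hom_eq_zero K (by omega) _

end BrauerLoopGraph

/-! ### Finitely generated projective modules over `Ω(T)` -/

namespace BrauerLoopGraph

variable (K : Type*) [Field K] {V E : Type*} [Fintype E] (T : BrauerLoopGraph V E)

/-- Up to paths of positive length, `e_z Ω(T)` is spanned by `e_z`. -/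
theorem exists_idem_mul_sub_smul_mem (z : E) (a : T.Omega K) :
    ∃ c : K, T.idem K z * a - c • T.idem K z ∈ T.turnSpan K 1 := by
  have ha := T.mem_turnSpan_zero K a
  induction ha using Submodule.span_induction with
  | mem a h =>
    obtain ⟨x, k, -, rfl⟩ := h
    by_cases hx : z = x.1
    · rcases Nat.eq_zero_or_pos k with rfl | hk
      · refine ⟨1, ?_⟩
        rw [turn_zero, ← hx, idem_mul_self, one_smul, sub_self]
        exact zero_mem _
      · refine ⟨0, ?_⟩
        rw [zero_smul, sub_zero, hx, idem_mul_turn]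
        exact T.turn_mem_turnSpan K hk
    · refine ⟨0, ?_⟩
      rw [T.idem_mul_turn_of_ne K hx, zero_smul, sub_zero]
      exact zero_mem _
  | zero =>
    refine ⟨0, ?_⟩
    rw [mul_zero, zero_smul, sub_zero]
    exact zero_mem _
  | add a b _ _ ha hb =>
    obtain ⟨c, hc⟩ := ha
    obtain ⟨d, hd⟩ := hb
    refine ⟨c + d, ?_⟩
    rw [mul_add, add_smul, add_sub_add_comm]
    exact add_mem hc hd
  | smul r a _ ha =>
    obtain ⟨c, hc⟩ := ha
    refine ⟨r * c, ?_⟩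
    rw [mul_smul_comm, mul_smul, ← smul_sub]
    exact Submodule.smul_mem _ _ hc

theorem pow_mem_turnSpan {a : T.Omega K} (ha : a ∈ T.turnSpan K 1) (n : ℕ) :
    a ^ n ∈ T.turnSpan K n := by
  induction n with
  | zero => exact T.mem_turnSpan_zero K _
  | succ n ih =>
    rw [pow_succ]
    exact T.mul_mem_turnSpan_add_one K ih ha

theorem isNilpotent_of_mem_turnSpan {a : T.Omega K} (ha : a ∈ T.turnSpan K 1) :
    IsNilpotent a := by
  refine ⟨Fintype.card (E × Bool) + 1, ?_⟩
  have := T.pow_mem_turnSpan K ha (Fintype.card (E × Bool) + 1)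
  rwa [T.turnSpan_eq_bot K (Nat.lt_succ_self _), Submodule.mem_bot] at this

/-- The ring `e_z Ω(T) e_z` is local: right multiplication on `P(z)` by an element outside the span
of the paths of positive length is invertible. -/
theorem exists_rightMul_comp_eq_id {z : E} {a : T.Omega K} (ha : T.idem K z * a ∉ T.turnSpan K 1) :
    ∃ b, (T.rightMul K z z b).comp (T.rightMul K z z a) = LinearMap.id := by
  obtain ⟨c, hc⟩ := T.exists_idem_mul_sub_smul_mem K z a
  have hc0 : c ≠ 0 := by
    rintro rfl
    rw [zero_smul, sub_zero] at hc
    exact ha hc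
  let n := (T.idem K z * a - c • T.idem K z) * T.idem K z
  have hn : n = T.idem K z * a * T.idem K z - c • T.idem K z := by
    change (_ - _) * _ = _
    rw [sub_mul, smul_mul_assoc, idem_mul_self]
  have hu : IsUnit (c • (1 : T.Omega K) + n) := by
    refine IsNilpotent.isUnit_add_left_of_commute
      (T.isNilpotent_of_mem_turnSpan K (T.mul_mem_turnSpan K hc _)) ?_ ?_
    · rw [← Algebra.algebraMap_eq_smul_one]
      exact (IsUnit.mk0 c hc0).map _
    · rw [← Algebra.algebraMap_eq_smul_one]
      exact Algebra.commutes' c n |>.symm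
  obtain ⟨u, hu⟩ := hu
  refine ⟨((u⁻¹ : (T.Omega K)ˣ) : T.Omega K), ?_⟩
  have h1 : T.idem K z * a * T.idem K z = T.idem K z * u := by
    rw [hu, hn, mul_add, mul_sub, mul_smul_comm, mul_smul_comm, mul_one, idem_mul_self,
      ← mul_assoc, ← mul_assoc, idem_mul_self]
    abel
  rw [rightMul_comp]
  refine LinearMap.ext fun p => Subtype.ext ?_
  rw [coe_rightMul, ← T.mul_idem_of_mem_proj K p.2, mul_assoc, ← mul_assoc (T.idem K z),
    ← mul_assoc (T.idem K z), ← mul_assoc (T.idem K z), h1, mul_assoc (T.idem K z), Units.mul_inv,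
    mul_one, idem_mul_self]
  exact (T.mul_idem_of_mem_proj K p.2).symm ▸ rfl

/-- Every nonzero projective module has some `P(z)` as a direct summand. -/
theorem exists_retraction_onto_proj (M : Type*) [AddCommGroup M] [Module (T.Omega K) M]
    [Module.Projective (T.Omega K) M] [Nontrivial M] :
    ∃ (z : E) (ι : T.proj K z →ₗ[T.Omega K] M) (ρ : M →ₗ[T.Omega K] T.proj K z),
      ρ.comp ι = LinearMap.id ∧ T.idem K z ≠ 0 := by
  obtain ⟨s, hs⟩ := Module.projective_def.1 ‹Module.Projective (T.Omega K) M›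
  -- if all coordinates had values in the radical, then they would have values in its powers
  obtain ⟨m, q, hmq⟩ : ∃ m q, s m q ∉ T.turnSpan K 1 := by
    by_contra! h
    have key : ∀ n m q, s m q ∈ T.turnSpan K n := by
      intro n
      induction n with
      | zero => exact fun m q => T.mem_turnSpan_zero K _
      | succ n ih =>
        intro m q
        have hm : m = (s m).sum fun i a => a • i := (hs m).symm
        rw [hm, Finsupp.sum, map_sum, Finsupp.finsetSum_apply]
        refine sum_mem fun i _ => ?_
        rw [map_smul, Finsupp.smul_apply, smul_eq_mul]
        exact T.mul_mem_turnSpan_add_one K (ih m i) (h i q)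
    obtain ⟨m, hm⟩ := exists_ne (0 : M)
    refine hm ?_
    have h0 : s m = 0 := Finsupp.ext fun q => by
      have := key (Fintype.card (E × Bool) + 1) m q
      rwa [T.turnSpan_eq_bot K (Nat.lt_succ_self _), Submodule.mem_bot] at this
    rw [← hs m, h0, map_zero]
  obtain ⟨z, hz⟩ : ∃ z, T.idem K z * s m q ∉ T.turnSpan K 1 := by
    by_contra! h
    refine hmq ?_
    rw [← one_mul (s m q), ← sum_idem, Finset.sum_mul]
    exact sum_mem fun z _ => h z
  obtain ⟨b, hb⟩ := T.exists_rightMul_comp_eq_id K hz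
  let ι : T.proj K z →ₗ[T.Omega K] M :=
    (LinearMap.toSpanSingleton (T.Omega K) M m).comp (T.proj K z).subtype
  let ρ : M →ₗ[T.Omega K] T.proj K z :=
    ((LinearMap.toSpanSingleton (T.Omega K) (T.Omega K) (T.idem K z)).comp
      ((Finsupp.lapply q).comp s)).codRestrict (T.proj K z) fun x =>
        Submodule.smul_mem _ _ (T.idem_mem_proj K z)
  refine ⟨z, ι, (T.rightMul K z z b).comp ρ, ?_, fun h0 => hz ?_⟩
  · rw [LinearMap.comp_assoc, ← hb]
    congr 1
    refine LinearMap.ext fun p => Subtype.ext ?_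
    change s ((p : T.Omega K) • m) q * T.idem K z = p * (s m q * T.idem K z)
    rw [map_smul, Finsupp.smul_apply, smul_eq_mul, mul_assoc]
  · rw [h0, zero_mul]
    exact zero_mem _

theorem isArtinianRing_omega : IsArtinianRing (T.Omega K) :=
  have := T.finite_omega K
  IsArtinianRing.of_finite K (T.Omega K)

universe u v w

variable {K : Type u} [Field K] {V : Type v} {E : Type w} [Fintype E] (T : BrauerLoopGraph V E)

/-- Krull–Schmidt for `Ω(T)`, as an induction principle: the finitely generated projective modules
arise from the modules `P(z)` by split extensions. -/
theorem projective_induction (motive : ModuleCat.{max u w} (T.Omega K) → Prop)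
    (subsingleton : ∀ M : ModuleCat.{max u w} (T.Omega K), Subsingleton M → motive M)
    (split : ∀ S : ShortComplex (ModuleCat.{max u w} (T.Omega K)), S.Splitting → motive S.X₁ →
      motive S.X₃ → motive S.X₂)
    (proj : ∀ z, motive (ModuleCat.of _ (T.proj K z)))
    (M : ModuleCat.{max u w} (T.Omega K)) (h : Module.Finite (T.Omega K) M)
    (h' : Module.Projective (T.Omega K) M) : motive M := by
  have hart := T.isArtinianRing_omega K
  induction hl : Module.length (T.Omega K) M using WellFoundedLT.induction generalizing M with
  | ind l ih =>
    rcases subsingleton_or_nontrivial M with hM | hM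
    · exact subsingleton M hM
    obtain ⟨z, ι, ρ, h1, hz⟩ := T.exists_retraction_onto_proj K M
    have h1' : ∀ p, ρ (ι p) = p := LinearMap.congr_fun h1
    let π : M →ₗ[T.Omega K] LinearMap.ker ρ :=
      (LinearMap.id - ι.comp ρ).codRestrict _ fun m => by
        rw [LinearMap.mem_ker, LinearMap.sub_apply, LinearMap.comp_apply, LinearMap.id_apply,
          map_sub, h1', sub_self]
    have hπ : π.comp (LinearMap.ker ρ).subtype = LinearMap.id := by
      refine LinearMap.ext fun m => Subtype.ext ?_
      change m.1 - ι (ρ m.1) = m.1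
      rw [LinearMap.mem_ker.1 m.2, map_zero, sub_zero]
    let S : ShortComplex (ModuleCat.{max u w} (T.Omega K)) :=
      ShortComplex.mk (X₁ := ModuleCat.of _ (LinearMap.ker ρ)) (X₂ := M)
        (X₃ := ModuleCat.of _ (T.proj K z)) (ModuleCat.ofHom (LinearMap.ker ρ).subtype)
        (ModuleCat.ofHom ρ) (ModuleCat.hom_ext (LinearMap.ext fun m => LinearMap.mem_ker.1 m.2))
    let σ : S.Splitting :=
      { r := ModuleCat.ofHom π
        s := ModuleCat.ofHom ι
        f_r := ModuleCat.hom_ext hπ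
        s_g := ModuleCat.hom_ext h1
        id := ModuleCat.hom_ext (LinearMap.ext fun m => sub_add_cancel m (ι (ρ m))) }
    refine split S σ ?_ (proj z)
    · have hfin : Module.Finite (T.Omega K) (LinearMap.ker ρ) :=
        Module.Finite.of_surjective π (LinearMap.surjective_of_comp_eq_id _ _ hπ)
      have hproj : Module.Projective (T.Omega K) (LinearMap.ker ρ) :=
        Module.Projective.of_split _ _ hπ
      refine ih _ ?_ (ModuleCat.of _ (LinearMap.ker ρ)) hfin hproj rfl
      rw [← hl]
      refine Submodule.length_lt fun htop => hz ?_
      have h2 : ρ (ι ⟨_, T.idem_mem_proj K z⟩) = 0 := by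
        rw [LinearMap.ker_eq_top.1 htop, LinearMap.zero_apply]
      rw [h1'] at h2
      exact congrArg Subtype.val h2

end BrauerLoopGraph

/-! ### Triangulated subcategories of the homotopy category -/

section Triangulated

universe w v

variable {A : Type v} [Ring A]

namespace CochainComplex

variable (C : CochainComplex (ModuleCat.{w} A) ℤ) (N : ∀ n, Submodule A (C.X n))
  (hN : ∀ i j, N i ≤ (N j).comap (C.d i j).hom)

/-- The subcomplex given by submodules that are compatible with the differential. -/
def subcomplex : CochainComplex (ModuleCat.{w} A) ℤ where
  X n := ModuleCat.of A (N n)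
  d i j := ModuleCat.ofHom ((C.d i j).hom.restrict (hN i j))
  shape i j h := ModuleCat.hom_ext (LinearMap.ext fun x => Subtype.ext (by
    have := LinearMap.congr_fun (congrArg ModuleCat.Hom.hom (C.shape i j h)) x.1
    exact this))
  d_comp_d' i j k _ _ := ModuleCat.hom_ext (LinearMap.ext fun x => Subtype.ext (by
    have := LinearMap.congr_fun (congrArg ModuleCat.Hom.hom (C.d_comp_d i j k)) x.1
    exact this))

/-- The quotient complex by submodules that are compatible with the differential. -/
def quotcomplex : CochainComplex (ModuleCat.{w} A) ℤ where
  X n := ModuleCat.of A (C.X n ⧸ N n)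
  d i j := ModuleCat.ofHom ((N i).mapQ (N j) (C.d i j).hom (hN i j))
  shape i j h := ModuleCat.hom_ext (Submodule.linearMap_qext _ (LinearMap.ext fun x => by
    have := LinearMap.congr_fun (congrArg ModuleCat.Hom.hom (C.shape i j h)) x
    exact congrArg (Submodule.Quotient.mk (p := N j)) this))
  d_comp_d' i j k _ _ := ModuleCat.hom_ext (Submodule.linearMap_qext _ (LinearMap.ext fun x => by
    have := LinearMap.congr_fun (congrArg ModuleCat.Hom.hom (C.d_comp_d i j k)) x
    exact congrArg (Submodule.Quotient.mk (p := N k)) this))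

/-- The short exact sequence of a subcomplex and its quotient complex. -/
def subquotSequence : ShortComplex (CochainComplex (ModuleCat.{w} A) ℤ) where
  X₁ := C.subcomplex N hN
  X₂ := C
  X₃ := C.quotcomplex N hN
  f := { f n := ModuleCat.ofHom (N n).subtype }
  g := { f n := ModuleCat.ofHom (N n).mkQ }
  zero := by
    ext n x
    exact (Submodule.Quotient.mk_eq_zero _).2 x.2

/-- A splitting of a short exact sequence of modules `N → M → M ⧸ N` from a retraction onto `N`. -/
def _root_.Submodule.splittingOfRetraction {M : Type w} [AddCommGroup M] [Module A M]
    (N : Submodule A M) (r : M →ₗ[A] N) (hr : ∀ x : N, r x = x)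
    (X : ShortComplex (ModuleCat.{w} A)) (hX : X = ShortComplex.mk (ModuleCat.ofHom N.subtype)
      (ModuleCat.ofHom N.mkQ) (ModuleCat.hom_ext (LinearMap.ext fun x =>
        (Submodule.Quotient.mk_eq_zero _).2 x.2))) : X.Splitting := by
  subst hX
  exact
  { r := ModuleCat.ofHom r
    s := ModuleCat.ofHom (N.liftQ (LinearMap.id - N.subtype.comp r) fun x hx => by
      rw [LinearMap.mem_ker, LinearMap.sub_apply, LinearMap.comp_apply, hr ⟨x, hx⟩]
      exact sub_self x)
    f_r := ModuleCat.hom_ext (LinearMap.ext fun x => hr x)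
    s_g := ModuleCat.hom_ext (Submodule.linearMap_qext _ (LinearMap.ext fun x => by
      change Submodule.Quotient.mk (p := N) (x - (r x : M)) = Submodule.Quotient.mk x
      rw [Submodule.Quotient.eq, sub_sub_cancel_left]
      exact neg_mem (r x).2))
    id := ModuleCat.hom_ext (LinearMap.ext fun x => by
      change (r x : M) + (x - (r x : M)) = x
      rw [add_sub_cancel]) }

/-- The sequence of a subcomplex and its quotient complex splits degreewise if the subcomplex has
degreewise retractions. -/
def subquotSplitting (r : ∀ n, C.X n →ₗ[A] N n) (hr : ∀ n (x : N n), r n x = x) (n : ℤ) :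
    ((C.subquotSequence N hN).map (HomologicalComplex.eval _ _ n)).Splitting :=
  (N n).splittingOfRetraction (r n) (hr n) _ rfl

end CochainComplex

open Pretriangulated in
theorem distinguished_of_splitting {X : ShortComplex (CochainComplex (ModuleCat.{w} A) ℤ)}
    (σ : ∀ n, (X.map (HomologicalComplex.eval _ _ n)).Splitting) :
    CochainComplex.trianglehOfDegreewiseSplit X σ ∈ distTriang (HoCat.{w} A) :=
  (HomotopyCategory.distinguished_iff_iso_trianglehOfDegreewiseSplit _).2 ⟨X, σ, ⟨Iso.refl _⟩⟩

variable (S : ObjectProperty (HoCat.{w} A)) [S.IsClosedUnderIsomorphisms]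

/-- The modules which belong to `S` as complexes concentrated in degree `0`. -/
def stalkProp (M : ModuleCat.{w} A) : Prop := S ((HomotopyCategory.singleFunctor _ 0).obj M)

theorem stalkProp_of_iso {M M' : ModuleCat.{w} A} (e : M ≅ M') (h : stalkProp S M) :
    stalkProp S M' :=
  S.prop_of_iso ((HomotopyCategory.singleFunctor _ 0).mapIso e) h

variable [S.IsTriangulated]

theorem prop_middle_of_splitting {X : ShortComplex (CochainComplex (ModuleCat.{w} A) ℤ)}
    (σ : ∀ n, (X.map (HomologicalComplex.eval _ _ n)).Splitting)
    (h₁ : S (toHo X.X₁)) (h₃ : S (toHo X.X₃)) : S (toHo X.X₂) :=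
  S.ext_of_isTriangulatedClosed₂ _ (distinguished_of_splitting σ) h₁ h₃

theorem prop_left_of_splitting {X : ShortComplex (CochainComplex (ModuleCat.{w} A) ℤ)}
    (σ : ∀ n, (X.map (HomologicalComplex.eval _ _ n)).Splitting)
    (h₂ : S (toHo X.X₂)) (h₃ : S (toHo X.X₃)) : S (toHo X.X₁) :=
  S.ext_of_isTriangulatedClosed₁ _ (distinguished_of_splitting σ) h₂ h₃

theorem prop_toHo_of_isZero {C : CochainComplex (ModuleCat.{w} A) ℤ} (h : ∀ n, IsZero (C.X n)) :
    S (toHo C) := by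
  have h0 : IsZero C := (IsZero.iff_id_eq_zero C).2 (HomologicalComplex.hom_ext _ _ fun n =>
    (h n).eq_of_src _ _)
  exact S.prop_of_isZero ((HomotopyCategory.quotient _ _).map_isZero h0)

theorem stalkProp_of_isZero {M : ModuleCat.{w} A} (h : IsZero M) : stalkProp S M :=
  S.prop_of_isZero ((HomotopyCategory.singleFunctor _ 0).map_isZero h)

theorem stalkProp_of_splitting {X : ShortComplex (ModuleCat.{w} A)} (σ : X.Splitting)
    (h₁ : stalkProp S X.X₁) (h₃ : stalkProp S X.X₃) : stalkProp S X.X₂ :=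
  prop_middle_of_splitting S (X := X.map (CochainComplex.singleFunctor _ 0))
    (fun n => (σ.map (CochainComplex.singleFunctor _ 0)).map (HomologicalComplex.eval _ _ n)) h₁ h₃

/-- For a complex concentrated in one degree, membership in `S` does not depend on this degree. -/
theorem prop_toHo_iff_stalkProp {C : CochainComplex (ModuleCat.{w} A) ℤ} {b : ℤ}
    (h : ∀ n, n ≠ b → IsZero (C.X n)) : S (toHo C) ↔ stalkProp S (C.X b) := by
  have h1 : C.IsStrictlyGE b := (C.isStrictlyGE_iff b).2 fun i hi => h i hi.ne
  have h2 : C.IsStrictlyLE b := (C.isStrictlyLE_iff b).2 fun i hi => h i hi.ne'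
  obtain ⟨M, ⟨e⟩⟩ := C.exists_iso_single b
  have e' : C.X b ≅ M := (HomologicalComplex.eval _ _ b).mapIso e ≪≫
    HomologicalComplex.singleObjXSelf (ComplexShape.up ℤ) b M
  have e'' : ((HomotopyCategory.singleFunctor (ModuleCat.{w} A) b).obj M)⟦b⟧ ≅
      (HomotopyCategory.singleFunctor (ModuleCat.{w} A) 0).obj M :=
    ((HomotopyCategory.singleFunctors (ModuleCat.{w} A)).shiftIso b 0 b (add_zero b)).app M
  have h3 : S (toHo C) ↔ S ((HomotopyCategory.singleFunctor (ModuleCat.{w} A) b).obj M) :=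
    S.prop_iff_of_iso ((HomotopyCategory.quotient _ _).mapIso e)
  rw [h3, ← ObjectProperty.prop_shift_iff_of_isStableUnderShift S _ b]
  exact (S.prop_iff_of_iso e'').trans
    (S.prop_iff_of_iso ((HomotopyCategory.singleFunctor _ 0).mapIso e'.symm))

open Classical in
/-- The submodules defining the subcomplex that consists of the term in degree `b`. -/
def stalkSubmodule (C : CochainComplex (ModuleCat.{w} A) ℤ) (b n : ℤ) : Submodule A (C.X n) :=
  if n = b then ⊤ else ⊥

theorem stalkSubmodule_self (C : CochainComplex (ModuleCat.{w} A) ℤ) (b : ℤ) :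
    stalkSubmodule C b b = ⊤ := if_pos rfl

theorem stalkSubmodule_of_ne (C : CochainComplex (ModuleCat.{w} A) ℤ) {b n : ℤ} (h : n ≠ b) :
    stalkSubmodule C b n = ⊥ := if_neg h

/-- Splitting off the last term of a complex: the sequence `C^b[-b] → C → C'` where `C'` is the
complex `C` without its last term `C^b`. -/
theorem exists_truncation (C : CochainComplex (ModuleCat.{w} A) ℤ) (b : ℤ)
    (hb : ∀ n, b < n → IsZero (C.X n)) :
    ∃ C' C'' : CochainComplex (ModuleCat.{w} A) ℤ,
      (S (toHo C') → S (toHo C'') → S (toHo C)) ∧ (S (toHo C) → S (toHo C'') → S (toHo C')) ∧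
      (∀ n, n ≠ b → IsZero (C'.X n)) ∧ Nonempty (C'.X b ≅ C.X b) ∧
      IsZero (C''.X b) ∧ ∀ n, n ≠ b → Nonempty (C''.X n ≅ C.X n) := by
  let N := stalkSubmodule C b
  have hN : ∀ i j, N i ≤ (N j).comap (C.d i j).hom := by
    intro i j x hx
    rw [Submodule.mem_comap]
    by_cases hi : i = b
    · subst hi
      have h0 : C.d i j = 0 := by
        by_cases hij : i + 1 = j
        · exact (hb j (by omega)).eq_of_tgt _ _
        · exact C.shape i j hij
      rw [h0]
      exact zero_mem _
    · have hx' : x = 0 := by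
        simpa only [N, stalkSubmodule_of_ne C hi, Submodule.mem_bot] using hx
      rw [hx', map_zero]
      exact zero_mem _
  have hr : ∀ n, ∃ r : C.X n →ₗ[A] N n, ∀ x : N n, r x = x := by
    intro n
    by_cases hn : n = b
    · subst hn
      exact ⟨LinearMap.id.codRestrict _ fun x => by
        simp only [N, stalkSubmodule_self]; trivial, fun x => rfl⟩
    · refine ⟨0, fun x => Subtype.ext ?_⟩
      have := x.2
      simp only [N, stalkSubmodule_of_ne C hn, Submodule.mem_bot] at this
      rw [this]
      rfl
  choose r hr using hr
  let σ := C.subquotSplitting N hN r hr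
  refine ⟨C.subcomplex N hN, C.quotcomplex N hN, prop_middle_of_splitting S σ,
    prop_left_of_splitting S σ, fun n hn => ?_, ?_, ?_, fun n hn => ?_⟩
  · have : Subsingleton (N n) := by
      simp only [N, stalkSubmodule_of_ne C hn]
      infer_instance
    exact ModuleCat.isZero_of_subsingleton (ModuleCat.of A (N n))
  · exact ⟨((LinearEquiv.ofEq _ _ (stalkSubmodule_self C b)).trans
      Submodule.topEquiv).toModuleIso⟩
  · have : Subsingleton (C.X b ⧸ N b) := by
      rw [Submodule.Quotient.subsingleton_iff]
      exact stalkSubmodule_self C b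
    exact ModuleCat.isZero_of_subsingleton (ModuleCat.of A (C.X b ⧸ N b))
  · exact ⟨((N n).quotEquivOfEqBot (stalkSubmodule_of_ne C hn)).toModuleIso⟩

/-- A bounded complex belongs to `S` if all its terms do. -/
theorem prop_toHo_of_stalkProp (k : ℕ) : ∀ (C : CochainComplex (ModuleCat.{w} A) ℤ) (b : ℤ),
    (∀ n, n ≤ b - k ∨ b < n → IsZero (C.X n)) → (∀ n, stalkProp S (C.X n)) → S (toHo C) := by
  induction k with
  | zero =>
    intro C b h _
    exact prop_toHo_of_isZero S fun n => h n (by omega)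
  | succ k ih =>
    intro C b h hs
    obtain ⟨C', C'', h1, -, h2, ⟨e⟩, h3, h4⟩ := exists_truncation S C b fun n hn => h n (.inr hn)
    refine h1 ((prop_toHo_iff_stalkProp S h2).2 (stalkProp_of_iso S e.symm (hs b)))
      (ih C'' (b - 1) (fun n hn => ?_) fun n => ?_)
    · by_cases hnb : n = b
      · exact hnb ▸ h3
      · obtain ⟨e⟩ := h4 n hnb
        exact (h n (by omega)).of_iso e
    · by_cases hnb : n = b
      · exact hnb ▸ stalkProp_of_isZero S h3
      · obtain ⟨e⟩ := h4 n hnb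
        exact stalkProp_of_iso S e.symm (hs n)

/-- If a bounded complex and all its terms but the last one belong to `S`, then so does the last
term. -/
theorem stalkProp_last (C : CochainComplex (ModuleCat.{w} A) ℤ) (b : ℤ) (k : ℕ)
    (h : ∀ n, n < b - k ∨ b < n → IsZero (C.X n)) (hs : ∀ n, n < b → stalkProp S (C.X n))
    (hC : S (toHo C)) : stalkProp S (C.X b) := by
  obtain ⟨C', C'', -, h1, h2, ⟨e⟩, h3, h4⟩ := exists_truncation S C b fun n hn => h n (.inr hn)
  refine stalkProp_of_iso S e ((prop_toHo_iff_stalkProp S h2).1 (h1 hC ?_))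
  refine prop_toHo_of_stalkProp S k C'' (b - 1) (fun n hn => ?_) fun n => ?_
  · by_cases hnb : n = b
    · exact hnb ▸ h3
    · obtain ⟨e⟩ := h4 n hnb
      exact (h n (by omega)).of_iso e
  · rcases lt_trichotomy n b with hnb | rfl | hnb
    · obtain ⟨e⟩ := h4 n hnb.ne
      exact stalkProp_of_iso S e.symm (hs n hnb)
    · exact stalkProp_of_isZero S h3
    · obtain ⟨e⟩ := h4 n hnb.ne'
      exact stalkProp_of_isZero S ((h n (.inr hnb)).of_iso e)

end Triangulated

/-! ### A criterion for direct sums to be tilting complexes -/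

section TiltingCriterion

universe w v t

variable {A : Type v} [Ring A] {I : Type t} [Fintype I] (Q : I → CochainComplex (ModuleCat.{w} A) ℤ)

theorem sum_biproduct_π_comp_ι {𝒞 : Type*} [Category 𝒞] [Preadditive 𝒞] (X : I → 𝒞)
    [HasBiproduct X] :
    ∑ i, biproduct.π X i ≫ biproduct.ι X i = 𝟙 (⨁ X) := by
  classical
  refine biproduct.hom_ext' _ _ fun i => ?_
  rw [Preadditive.comp_sum, Finset.sum_eq_single i, biproduct.ι_π_self_assoc, Category.comp_id]
  · intro j _ hj
    rw [biproduct.ι_π_ne_assoc _ hj.symm, zero_comp]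
  · exact fun h => absurd (Finset.mem_univ i) h

theorem isBoundedProjective_biproduct (h : ∀ i, IsBoundedProjective (Q i)) :
    IsBoundedProjective (⨁ Q) := by
  classical
  have total : ∀ n (x : (⨁ Q).X n), ∑ i, (biproduct.ι Q i).f n ((biproduct.π Q i).f n x) = x := by
    intro n x
    have h1 : ∑ i, (biproduct.π Q i).f n ≫ (biproduct.ι Q i).f n = 𝟙 ((⨁ Q).X n) := by
      have := congrArg (HomologicalComplex.eval _ _ n).map (sum_biproduct_π_comp_ι Q)
      rw [Functor.map_sum] at this
      exact this
    have h2 := LinearMap.congr_fun (congrArg ModuleCat.Hom.hom h1) x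
    rw [ModuleCat.hom_sum, LinearMap.sum_apply] at h2
    exact h2
  constructor
  · intro n
    have h1 : ∀ i, Module.Finite A ((Q i).X n) := fun i => ((h i).1 n).1
    have h2 : ∀ i, Module.Projective A ((Q i).X n) := fun i => ((h i).1 n).2
    have h3 : Module.Projective A (∀ i, (Q i).X n) :=
      Module.Projective.of_equiv (DirectSum.linearEquivFunOnFintype A I fun i => (Q i).X n)
    let f : (⨁ Q).X n →ₗ[A] ∀ i, (Q i).X n := LinearMap.pi fun i => ((biproduct.π Q i).f n).hom
    let g : (∀ i, (Q i).X n) →ₗ[A] (⨁ Q).X n :=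
      ∑ i, ((biproduct.ι Q i).f n).hom.comp (LinearMap.proj i)
    have hgf : g.comp f = LinearMap.id := LinearMap.ext fun x => by
      rw [LinearMap.comp_apply, LinearMap.sum_apply]
      exact total n x
    exact ⟨Module.Finite.of_surjective g fun x => ⟨f x, LinearMap.congr_fun hgf x⟩,
      Module.Projective.of_split f g hgf⟩
  · choose a b hab using fun i => (h i).2
    obtain ⟨a', ha'⟩ := (Set.finite_range a).bddBelow
    obtain ⟨b', hb'⟩ := (Set.finite_range b).bddAbove
    refine ⟨a', b', fun n hn => ?_⟩
    have : Subsingleton ((⨁ Q).X n) := by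
      refine subsingleton_of_forall_eq 0 fun x => ?_
      rw [← total n x]
      refine Finset.sum_eq_zero fun i _ => ?_
      have h0 : IsZero ((Q i).X n) := hab i n (hn.imp (fun h => h.trans_le (ha' ⟨i, rfl⟩))
        fun h => (hb' ⟨i, rfl⟩).trans_lt h)
      rw [h0.eq_of_tgt ((biproduct.π Q i).f n) 0]
      exact map_zero _
    exact ModuleCat.isZero_of_subsingleton _

/-- There are no nonzero morphisms in the homotopy category if all cocycles of the complex of
morphisms are coboundaries. -/
theorem toHo_hom_eq_zero {C D : CochainComplex (ModuleCat.{w} A) ℤ} {n : ℤ}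
    (h : ∀ g : CochainComplex.HomComplex.Cocycle C D n,
      g ∈ CochainComplex.HomComplex.coboundaries C D n) (f : toHo C ⟶ (toHo D)⟦n⟧) : f = 0 := by
  let e : (toHo D)⟦n⟧ ≅ toHo (D⟦n⟧) :=
    (((HomotopyCategory.quotient (ModuleCat.{w} A) (ComplexShape.up ℤ)).commShiftIso n).app D).symm
  obtain ⟨c, hc⟩ := (CochainComplex.HomComplex.CohomologyClass.toHom_bijective C D n).2 (f ≫ e.hom)
  obtain ⟨g, rfl⟩ := c.mk_surjective
  rw [(CochainComplex.HomComplex.CohomologyClass.mk_eq_zero_iff g).2 (h g), map_zero] at hc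
  rw [← cancel_mono e.hom, ← hc, zero_comp]

theorem toHo_biproduct_hom_eq_zero {n : ℤ}
    (h : ∀ i j (f : toHo (Q i) ⟶ (toHo (Q j))⟦n⟧), f = 0)
    (f : toHo (⨁ Q) ⟶ (toHo (⨁ Q))⟦n⟧) : f = 0 := by
  let F := HomotopyCategory.quotient (ModuleCat.{w} A) (ComplexShape.up ℤ)
  have total : (∑ i, F.map (biproduct.π Q i) ≫ F.map (biproduct.ι Q i)) = 𝟙 (toHo (⨁ Q)) := by
    simp only [← F.map_comp]
    rw [← F.map_sum, sum_biproduct_π_comp_ι]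
    exact F.map_id _
  rw [← Category.id_comp f, ← Category.comp_id f, ← (shiftFunctor _ n).map_id, ← total,
    Functor.map_sum, Preadditive.comp_sum, Preadditive.sum_comp]
  refine Finset.sum_eq_zero fun i _ => ?_
  rw [Preadditive.comp_sum]
  refine Finset.sum_eq_zero fun j _ => ?_
  have h0 := h i j (F.map (biproduct.ι Q i) ≫ f ≫ (F.map (biproduct.π Q j))⟦n⟧')
  calc _ = F.map (biproduct.π Q i) ≫ (F.map (biproduct.ι Q i) ≫ f ≫
        (F.map (biproduct.π Q j))⟦n⟧') ≫ (F.map (biproduct.ι Q j))⟦n⟧' := by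
        simp only [Functor.map_comp, Category.assoc]
    _ = 0 := by rw [h0, zero_comp, comp_zero]

/-- A summand of a finite direct sum of complexes is a retract of a single copy of the sum, where
this copy is written as a direct sum over `Fin 1`. -/
noncomputable def retractBiproduct (i : I) :
    Retract (toHo (Q i)) (⨁ fun _ : Fin 1 => toHo (⨁ Q)) where
  i := (HomotopyCategory.quotient _ _).map (biproduct.ι Q i) ≫
    biproduct.ι (fun _ : Fin 1 => toHo (⨁ Q)) 0
  r := biproduct.π (fun _ : Fin 1 => toHo (⨁ Q)) 0 ≫
    (HomotopyCategory.quotient _ _).map (biproduct.π Q i)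
  retract := by
    classical
    rw [Category.assoc, biproduct.ι_π_self_assoc, ← Functor.map_comp, biproduct.ι_π_self]
    exact CategoryTheory.Functor.map_id _ _

/-- A direct sum of bounded complexes of finitely generated projective modules is a tilting complex
if there are no morphisms between shifts of its summands, and if every triangulated subcategory
which contains the summands contains all finitely generated projective modules. -/
theorem isTiltingComplex_biproduct (h : ∀ i, IsBoundedProjective (Q i))
    (hom : ∀ n : ℤ, n ≠ 0 → ∀ i j (f : toHo (Q i) ⟶ (toHo (Q j))⟦n⟧), f = 0)
    (gen : ∀ S : ObjectProperty (HoCat.{w} A), S.IsTriangulated → S.IsClosedUnderIsomorphisms →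
      (∀ i, S (toHo (Q i))) → ∀ M : ModuleCat.{w} A, Module.Finite A M → Module.Projective A M →
      stalkProp S M) :
    IsTiltingComplex (⨁ Q) := by
  refine ⟨isBoundedProjective_biproduct Q h, fun n hn f =>
    toHo_biproduct_hom_eq_zero Q (hom n hn) f, fun S hS hS' hQ C ⟨hC, a, b, hab⟩ => ?_⟩
  refine prop_toHo_of_stalkProp S (b - a + 1).toNat C b (fun n hn => hab n (by omega)) fun n =>
    gen S hS hS' (fun i => hQ _ 1 ⟨retractBiproduct Q i⟩) _ (hC n).1 (hC n).2

end TiltingCriterion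

/-! ### The tilting complex -/

namespace BrauerLoopGraph

variable (K : Type*) [Field K] {V E : Type*} [Fintype E] (T : BrauerLoopGraph V E)

theorem subsingleton_term_none : Subsingleton (T.term K none) := ⟨fun _ _ => rfl⟩

theorem finite_term (o : Option (E × Bool)) : Module.Finite (T.Omega K) (T.term K o) := by
  cases o with
  | none =>
    have := T.subsingleton_term_none K
    infer_instance
  | some x => exact inferInstanceAs (Module.Finite (T.Omega K) (T.proj K x.1))

theorem projective_term (o : Option (E × Bool)) : Module.Projective (T.Omega K) (T.term K o) := by
  cases o with
  | none =>
    have := T.subsingleton_term_none K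
    infer_instance
  | some x =>
    refine Module.Projective.of_split (T.proj K x.1).subtype
      ((LinearMap.toSpanSingleton (T.Omega K) (T.Omega K) (T.idem K x.1)).codRestrict (T.proj K x.1)
        fun _ => Submodule.smul_mem _ _ (T.idem_mem_proj K x.1)) (LinearMap.ext fun p => ?_)
    exact Subtype.ext (T.mul_idem_of_mem_proj K p.2)

theorem isZero_rickardComplex_X {z : E} {n : ℤ} (hn : n < 0 ∨ T.depth z < n) :
    IsZero ((T.rickardComplex K z).X n) := by
  have h : entry (T.route z) n = none := by
    rcases hn with hn | hn
    · exact entry_of_neg _ hn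
    · obtain ⟨j, rfl⟩ := Int.eq_ofNat_of_zero_le (by omega : 0 ≤ n)
      rw [entry_natCast, List.getElem?_eq_none]
      rw [length_route]
      omega
  have := T.subsingleton_term_none K
  change IsZero (T.term K (entry (T.route z) n))
  rw [h]
  exact ModuleCat.isZero_of_subsingleton _

theorem isBoundedProjective_rickardComplex (z : E) : IsBoundedProjective (T.rickardComplex K z) :=
  ⟨fun _ => ⟨T.finite_term K _, T.projective_term K _⟩, 0, T.depth z,
    fun _ => T.isZero_rickardComplex_X K⟩

/-- The path in `Q_T` from an edge of `T` to the next edge is a part of a full turn which does not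
vanish in `Ω(T)`. -/
theorem link_ne_zero {x y : E × Bool} (h : T.Follows x y) (hd : T.depth y.1 = T.depth x.1 + 1) :
    T.link K x y ≠ 0 := by
  intro h0
  have hx : (opp x).1 ≠ T.loop := T.ne_loop_of_depth (x := opp x) h.1 hd
  have hxy : opp x ≠ y := by
    rintro rfl
    exact absurd hd (Nat.succ_ne_self _).symm
  refine T.turn_steps_mul_ne_zero K hx h.1 hxy ?_
  rw [← link_eq, h0, zero_mul]

theorem rickardComplex_d_ne_zero {z : E} {j : ℕ} (hj : j + 1 < (T.route z).length) :
    (T.rickardComplex K z).d (j : ℤ) ((j : ℤ) + 1) ≠ 0 := by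
  have h1 : entry (T.route z) (j : ℤ) = some (T.route z)[j] := by
    rw [entry_natCast, List.getElem?_eq_getElem]
  have h2 : entry (T.route z) ((j : ℤ) + 1) = some (T.route z)[j + 1] := by
    rw [← Nat.cast_succ, entry_natCast, List.getElem?_eq_getElem]
  have hf : T.Follows (T.route z)[j] (T.route z)[j + 1] :=
    List.isChain_iff_getElem.1 (T.isChain_route z) j hj
  have hd : T.depth (T.route z)[j + 1].1 = T.depth (T.route z)[j].1 + 1 := by
    rw [depth_route, depth_route]
  have key : ∀ o o' x y, o = some x → o' = some y → T.Follows x y →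
      T.depth y.1 = T.depth x.1 + 1 → T.termMap K o o' ≠ 0 := by
    rintro _ _ x y rfl rfl hf hd h0
    have h := (T.rightMul_eq_zero_iff K).1 (congrArg ModuleCat.Hom.hom h0)
    rw [T.idem_mul_link K, T.link_mul_idem K hf] at h
    exact T.link_ne_zero K hf hd h
  rw [rickardComplex_d]
  exact key _ _ _ _ h1 h2 hf hd

/-- A triangulated subcategory which contains the complexes `Q(z)` contains the modules `P(z)`: the
last term of `Q(z)` is `P(z)`, and the other ones are of the form `P(y)` with an edge `y` closer
to `S`. -/
theorem stalkProp_proj (S : ObjectProperty (HoCat (T.Omega K))) [S.IsTriangulated]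
    [S.IsClosedUnderIsomorphisms] (h : ∀ z, S (toHo (T.rickardComplex K z))) (z : E) :
    stalkProp S (ModuleCat.of _ (T.proj K z)) := by
  induction hd : T.depth z using Nat.strong_induction_on generalizing z with
  | _ k ih =>
    have h1 := stalkProp_last S (T.rickardComplex K z) k k
      (fun n hn => T.isZero_rickardComplex_X K (by omega)) (fun n hn => ?_) (h z)
    · have h2 : entry (T.route z) (k : ℤ) =
          some ((T.route z)[k]'(by rw [length_route]; omega)) := by
        rw [entry_natCast, List.getElem?_eq_getElem]
      have h3 : ((T.route z)[k]'(by rw [length_route]; omega)).1 = z := by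
        subst hd
        exact T.route_getElem_depth z
      change stalkProp S (T.term K (entry (T.route z) (k : ℤ))) at h1
      rw [h2] at h1
      rw [← h3]
      exact h1
    · change stalkProp S (T.term K (entry (T.route z) n))
      rcases h2 : entry (T.route z) n with _ | x
      · have := T.subsingleton_term_none K
        exact stalkProp_of_isZero S (ModuleCat.isZero_of_subsingleton _)
      · have := T.depth_of_entry h2
        exact ih _ (by omega) x.1 rfl

end BrauerLoopGraph

theorem mainTheorem5 {K V E : Type*} [Field K] [IsAlgClosed K] [Fintype V] [Fintype E]
    (T : BrauerLoopGraph V E) :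
    (∀ (z : E) (j : ℕ), j + 1 < (T.route z).length →
      (T.rickardComplex K z).d (j : ℤ) ((j : ℤ) + 1) ≠ 0) ∧
    IsTiltingComplex (⨁ fun z : E => T.rickardComplex K z) := by
  refine ⟨fun z j => T.rickardComplex_d_ne_zero K, isTiltingComplex_biproduct _
    (T.isBoundedProjective_rickardComplex K)
    (fun n hn z w => toHo_hom_eq_zero (T.cocycle_mem_coboundaries K hn)) ?_⟩
  intro S _ _ h
  exact T.projective_induction (stalkProp S)
    (fun M _ => stalkProp_of_isZero S (ModuleCat.isZero_of_subsingleton M))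
    (fun X σ => stalkProp_of_splitting S σ) (T.stalkProp_proj K S h)
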